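/- Let $q\in\mathbb{C}$ with $|q|<1$. Write $(a;q)_n=\prod_{k=0}^{n-1}(1-aq^k)$ for $n\ge 0$ and $(a;q)_\infty=\prod_{k=0}^{\infty}(1-aq^k)$, and let \begin{align*} S_1(q)&=\sum_{i,j\ge 0}\frac{q^{\frac12 i^2-ij+2j^2-\frac12 i+2j}}{(q^3;q^3)_i(q^3;q^3)_j}, & S_2(q)&=\sum_{i,j\ge 0}\frac{q^{\frac12 i^2-ij+2j^2+\frac32 i}}{(q^3;q^3)_i(q^3;q^3)_j},\\ S_3(q)&=\sum_{i,j\ge 0}\frac{q^{2i^2+2ij+2j^2-2i-j}}{(q^3;q^3)_i(q^3;q^3)_j}, & S_4(q)&=\sum_{i,j\ge 0}\frac{q^{2i^2+2ij+2j^2}}{(q^3;q^3)_i(q^3;q^3)_j} \end{align*} (all exponents are non-negative integers, and $q^0=1$ also for $q=0$). These four double series converge absolutely, the product $(-q^3;q^3)_\infty$ converges, and $$S_1(q)=(-q^3;q^3)_\infty\,S_3(q),\qquad S_2(q)=(-q^3;q^3)_\infty\,S_4(q).$$ -/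

import Mathlib

noncomputable section

/-- The finite `q`-shifted factorial `(a; q)_n = ∏_{k=0}^{n-1} (1 - a q^k)`. -/
def qPoch (a q : ℂ) (n : ℕ) : ℂ := ∏ k ∈ Finset.range n, (1 - a * q ^ k)

/-- The infinite `q`-shifted factorial `(a; q)_∞ = ∏_{k=0}^∞ (1 - a q^k)`. -/
def qPochInf (a q : ℂ) : ℂ := ∏' k : ℕ, (1 - a * q ^ k)

/-- The exponent `i²/2 - ij + 2j² - i/2 + 2j`, an integer since `i² - i` is even. -/
def exponent1 (i j : ℤ) : ℤ := (i ^ 2 - i) / 2 - i * j + 2 * j ^ 2 + 2 * j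

/-- The exponent `i²/2 - ij + 2j² + 3i/2`, an integer since `i² + 3i` is even. -/
def exponent2 (i j : ℤ) : ℤ := (i ^ 2 + 3 * i) / 2 - i * j + 2 * j ^ 2

/-- The exponent `2i² + 2ij + 2j² - 2i - j`. -/
def exponent3 (i j : ℤ) : ℤ := 2 * i ^ 2 + 2 * i * j + 2 * j ^ 2 - 2 * i - j

/-- The exponent `2i² + 2ij + 2j²`. -/
def exponent4 (i j : ℤ) : ℤ := 2 * i ^ 2 + 2 * i * j + 2 * j ^ 2

/-- The integer division in `exponent1` is exact. -/
theorem exponent1_cast (i j : ℤ) :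
    (exponent1 i j : ℚ) = 1 / 2 * i ^ 2 - i * j + 2 * j ^ 2 - 1 / 2 * i + 2 * j := by
  have h : (2 : ℤ) ∣ i ^ 2 - i := by
    have := Int.even_mul_pred_self i
    rw [show i ^ 2 - i = i * (i - 1) by ring]
    exact this.two_dvd
  unfold exponent1
  push_cast [Int.cast_div h (by norm_num : ((2 : ℤ) : ℚ) ≠ 0)]
  ring

/-- The integer division in `exponent2` is exact. -/
theorem exponent2_cast (i j : ℤ) :
    (exponent2 i j : ℚ) = 1 / 2 * i ^ 2 - i * j + 2 * j ^ 2 + 3 / 2 * i := by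
  have h : (2 : ℤ) ∣ i ^ 2 + 3 * i := by
    have := (Int.even_mul_succ_self i).two_dvd
    rw [show i ^ 2 + 3 * i = i * (i + 1) + 2 * i by ring]
    exact dvd_add this (dvd_mul_right 2 i)
  unfold exponent2
  push_cast [Int.cast_div h (by norm_num : ((2 : ℤ) : ℚ) ≠ 0)]
  ring

/-- The term `q^{e(i,j)} / ((q³; q³)_i (q³; q³)_j)` of a double series, at `p = (i, j)`. -/
def nahmTerm (e : ℤ → ℤ → ℤ) (q : ℂ) (p : ℕ × ℕ) : ℂ :=
  q ^ e p.1 p.2 / (qPoch (q ^ 3) (q ^ 3) p.1 * qPoch (q ^ 3) (q ^ 3) p.2)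

/-- The first Nahm sum of Zagier's Example 5. -/
def S₁ (q : ℂ) : ℂ := ∑' p : ℕ × ℕ, nahmTerm exponent1 q p

/-- The second Nahm sum of Zagier's Example 5. -/
def S₂ (q : ℂ) : ℂ := ∑' p : ℕ × ℕ, nahmTerm exponent2 q p

/-- The first Nahm sum of Zagier's Example 10. -/
def S₃ (q : ℂ) : ℂ := ∑' p : ℕ × ℕ, nahmTerm exponent3 q p

/-- The second Nahm sum of Zagier's Example 10. -/
def S₄ (q : ℂ) : ℂ := ∑' p : ℕ × ℕ, nahmTerm exponent4 q p

end

open Filter Topology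

/-! ### The `q`-shifted factorial -/

/-! Put q = s², R = s³, x = s⁶. Each pair of double series is embedded in a one-parameter family:
F_l = `exFive` has F_0 = S₂ and F_(-1) = s S₁, while G_n = `exTen` has G_0 = S₄ and G_1 = s S₃.
Shifting a summation index gives a second-order recurrence for F (`exFive_rec`) and a third-order
one for G (`exTen_rec`).

The recurrence of F is adjoint to that of the Rogers series ρ_l at -R, so a bilinear expression in ρ
and F is constant in l. Its limit at infinity yields ρ_0 S₂ + s ρ_1 S₁ = θ(s)/(x;x)_∞
(`exFive_connection`). Similarly `residueSeries` solves the adjoint of the recurrence of G, which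
evaluates σ_0 S₄ + s σ_1 S₃ with σ = `slaterSeries` (`exTen_connection`). Since σ_l = ρ_l/(R;R²)_∞
(`slaterSeries_eq`), Euler's product identities turn this into (-x;x)_∞ (ρ_0 S₄ + s ρ_1 S₃) =
θ(s)/(x;x)_∞.

Subtraction leaves one linear relation between the two differences S₂ - (-x;x)_∞ S₄ and S₁ -
(-x;x)_∞ S₃ (`nahm_relation`). The differences depend on s² only, so replacing s by -s gives a
second relation. The determinant of the system is, up to sign, s times the Casoratian of the Rogers
series at R and -R, which equals 2 (`rogersSeries_casoratian`). Hence both differences vanish when s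
≠ 0; q = 0 is checked directly. -/

theorem qPoch_succ (a q : ℂ) (n : ℕ) : qPoch a q (n + 1) = qPoch a q n * (1 - a * q ^ n) :=
  Finset.prod_range_succ _ _

theorem qPoch_zero (a q : ℂ) : qPoch a q 0 = 1 := Finset.prod_range_zero _

theorem summable_norm_mul_pow (a : ℂ) {q : ℂ} (hq : ‖q‖ < 1) :
    Summable fun k : ℕ => ‖-(a * q ^ k)‖ := by
  simp only [norm_neg, norm_mul, norm_pow]
  exact (summable_geometric_of_lt_one (norm_nonneg q) hq).mul_left _

theorem multipliable_one_sub_mul_pow (a : ℂ) {q : ℂ} (hq : ‖q‖ < 1) :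
    Multipliable fun k : ℕ => 1 - a * q ^ k := by
  simpa only [sub_eq_add_neg] using
    multipliable_one_add_of_summable (summable_norm_mul_pow a hq)

theorem tendsto_qPoch (a : ℂ) {q : ℂ} (hq : ‖q‖ < 1) :
    Tendsto (qPoch a q) atTop (𝓝 (qPochInf a q)) :=
  (multipliable_one_sub_mul_pow a hq).hasProd.tendsto_prod_nat

theorem one_sub_ne_zero_of_norm_lt {x : ℂ} (hx : ‖x‖ < 1) : 1 - x ≠ 0 := by
  intro h
  rw [sub_eq_zero] at h
  simp [← h] at hx

theorem norm_mul_pow_lt_one {a q : ℂ} (ha : ‖a‖ < 1) (hq : ‖q‖ < 1) (k : ℕ) :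
    ‖a * q ^ k‖ < 1 := by
  rw [norm_mul, norm_pow]
  exact (mul_le_of_le_one_right (norm_nonneg a)
    (pow_le_one₀ (norm_nonneg q) hq.le)).trans_lt ha

theorem qPoch_ne_zero {a q : ℂ} (ha : ‖a‖ < 1) (hq : ‖q‖ < 1) (n : ℕ) : qPoch a q n ≠ 0 :=
  Finset.prod_ne_zero_iff.2 fun k _ => one_sub_ne_zero_of_norm_lt (norm_mul_pow_lt_one ha hq k)

theorem qPochInf_ne_zero {a q : ℂ} (ha : ‖a‖ < 1) (hq : ‖q‖ < 1) : qPochInf a q ≠ 0 := by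
  have h := tprod_one_add_ne_zero_of_summable (f := fun k : ℕ => -(a * q ^ k))
    (fun k => by
      rw [← sub_eq_add_neg]
      exact one_sub_ne_zero_of_norm_lt (norm_mul_pow_lt_one ha hq k))
    (summable_norm_mul_pow a hq)
  simpa only [qPochInf, ← sub_eq_add_neg] using h

theorem tendsto_inv_qPoch {a q : ℂ} (ha : ‖a‖ < 1) (hq : ‖q‖ < 1) :
    Tendsto (fun n => (qPoch a q n)⁻¹) atTop (𝓝 (qPochInf a q)⁻¹) :=
  (tendsto_qPoch a hq).inv₀ (qPochInf_ne_zero ha hq)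

theorem exists_norm_inv_qPoch_le {a q : ℂ} (ha : ‖a‖ < 1) (hq : ‖q‖ < 1) :
    ∃ B, ∀ n, ‖(qPoch a q n)⁻¹‖ ≤ B := by
  obtain ⟨B, hB⟩ := (Metric.isBounded_range_of_tendsto _ (tendsto_inv_qPoch ha hq)).exists_norm_le
  exact ⟨B, fun n => hB _ ⟨n, rfl⟩⟩

theorem one_sub_pow_mul_inv_qPoch_succ {x : ℂ} (hx : ‖x‖ < 1) (k : ℕ) :
    (1 - x ^ (k + 1)) * (qPoch x x (k + 1))⁻¹ = (qPoch x x k)⁻¹ := by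
  have h := qPoch_ne_zero hx hx (k + 1)
  rw [qPoch_succ, ← pow_succ'] at h ⊢
  rw [mul_inv, mul_left_comm, mul_inv_cancel₀ (right_ne_zero_of_mul h), mul_one]

theorem one_sub_mul_inv_qPoch_succ {a q : ℂ} (ha : ‖a‖ < 1) (hq : ‖q‖ < 1) (k : ℕ) :
    (1 - a * q ^ k) * (qPoch a q (k + 1))⁻¹ = (qPoch a q k)⁻¹ := by
  have h := qPoch_ne_zero ha hq (k + 1)
  rw [qPoch_succ] at h ⊢
  rw [mul_inv, mul_left_comm, mul_inv_cancel₀ (right_ne_zero_of_mul h), mul_one]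

theorem norm_pow_lt_one {x : ℂ} (hx : ‖x‖ < 1) {n : ℕ} (hn : n ≠ 0) : ‖x ^ n‖ < 1 := by
  rw [norm_pow]
  exact pow_lt_one₀ (norm_nonneg x) hx hn

theorem qPoch_sq_split (x : ℂ) (n : ℕ) :
    qPoch x x (2 * n) = qPoch x (x ^ 2) n * qPoch (x ^ 2) (x ^ 2) n := by
  induction n with
  | zero => simp [qPoch_zero]
  | succ n ih =>
    rw [show 2 * (n + 1) = 2 * n + 1 + 1 by ring, qPoch_succ, qPoch_succ, ih, qPoch_succ,
      qPoch_succ]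
    ring

theorem qPoch_sq_sq (x : ℂ) (n : ℕ) :
    qPoch (x ^ 2) (x ^ 2) n = qPoch x x n * qPoch (-x) x n := by
  rw [qPoch, qPoch, qPoch, ← Finset.prod_mul_distrib]
  exact Finset.prod_congr rfl fun k _ => by ring

theorem qPoch_mul_qPoch_neg (R : ℂ) (n : ℕ) :
    qPoch R (R ^ 2) n * qPoch (-R) (R ^ 2) n = qPoch (R ^ 2) ((R ^ 2) ^ 2) n := by
  rw [qPoch, qPoch, qPoch, ← Finset.prod_mul_distrib]
  exact Finset.prod_congr rfl fun k _ => by ring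

/-- Euler: `(-x; x)_∞ (x; x²)_∞ = 1`. -/
theorem qPochInf_neg_mul_qPochInf_sq {x : ℂ} (hx : ‖x‖ < 1) :
    qPochInf (-x) x * qPochInf x (x ^ 2) = 1 := by
  have hx2 := norm_pow_lt_one hx two_ne_zero
  have h1 : Tendsto (fun n => qPoch x x (2 * n)) atTop (𝓝 (qPochInf x x)) :=
    (tendsto_qPoch x hx).comp (tendsto_id.const_mul_atTop' two_pos)
  have h2 := (tendsto_qPoch x hx2).mul ((tendsto_qPoch x hx).mul (tendsto_qPoch (-x) hx))
  have h3 := tendsto_nhds_unique h1 (h2.congr fun n => by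
    rw [← qPoch_sq_sq, ← qPoch_sq_split])
  have h4 := qPochInf_ne_zero hx hx
  apply mul_left_cancel₀ h4
  linear_combination -h3

/-- Since (R;R²)_∞ (-R;R²)_∞ = (R²;R⁴)_∞, this is Euler's identity at R². -/
theorem qPochInf_triple_product {R : ℂ} (hR : ‖R‖ < 1) :
    qPochInf (-R ^ 2) (R ^ 2) * (qPochInf R (R ^ 2) * qPochInf (-R) (R ^ 2)) = 1 := by
  have hR2 := norm_pow_lt_one hR two_ne_zero
  rw [← qPochInf_neg_mul_qPochInf_sq hR2]
  congr 1
  exact tendsto_nhds_unique ((tendsto_qPoch R hR2).mul (tendsto_qPoch (-R) hR2))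
    ((tendsto_qPoch (R ^ 2) (norm_pow_lt_one hR2 two_ne_zero)).congr fun n =>
      (qPoch_mul_qPoch_neg R n).symm)

/-! ### Single series -/

/-- The mechanism behind the recurrences of the single series: a combination of shifted series
carries a factor that kills the term k = 0 and cancels the last factor of the denominator in the
others. -/
theorem tsum_eq_tsum_of_shift {f g : ℕ → ℂ} (hf : Summable f) (h0 : f 0 = 0)
    (h : ∀ k, f (k + 1) = g k) : ∑' k, f k = ∑' k, g k := by
  rw [hf.tsum_eq_zero_add, h0, zero_add]
  exact tsum_congr h

theorem norm_pow_quadratic_mul_le {R u : ℂ} (hR : ‖R‖ < 1) {B : ℝ} (hu : ‖u‖ ≤ B) {d : ℕ}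
    (hd : 0 < d) (l k : ℕ) : ‖R ^ (d * k ^ 2 + 2 * l * k) * u‖ ≤ B * ‖R‖ ^ (k + l * k) := by
  rw [norm_mul, norm_pow, mul_comm]
  refine mul_le_mul hu (pow_le_pow_of_le_one (norm_nonneg R) hR.le ?_) (by positivity)
    ((norm_nonneg u).trans hu)
  nlinarith [Nat.le_self_pow two_ne_zero k, Nat.zero_le (l * k)]

theorem summable_of_norm_le_pow {r B : ℝ} (hr0 : 0 ≤ r) (hr : r < 1) {f : ℕ → ℂ} {l : ℕ}
    (h : ∀ k, ‖f k‖ ≤ B * r ^ (k + l * k)) : Summable f := by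
  have hB : 0 ≤ B := by simpa using (norm_nonneg _).trans (h 0)
  refine ((summable_geometric_of_lt_one hr0 hr).mul_left B).of_norm_bounded fun k => (h k).trans ?_
  exact mul_le_mul_of_nonneg_left (pow_le_pow_of_le_one hr0 hr.le (by omega)) hB

/-- The factor r^(lk) removes every term with k ≥ 1 in the limit, and r^k dominates uniformly in l,
so only the term k = 0 survives. -/
theorem tendsto_tsum_of_norm_le_pow {r B : ℝ} (hr0 : 0 ≤ r) (hr : r < 1) {F : ℕ → ℕ → ℂ} {L : ℂ}
    (h : ∀ l k, ‖F l k‖ ≤ B * r ^ (k + l * k)) (h0 : Tendsto (fun l => F l 0) atTop (𝓝 L)) :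
    Tendsto (fun l => ∑' k, F l k) atTop (𝓝 L) := by
  have hB : 0 ≤ B := by simpa using (norm_nonneg _).trans (h 0 0)
  have hL : ∑' k : ℕ, (if k = 0 then L else 0) = L := tsum_ite_eq 0 _
  rw [← hL]
  refine tendsto_tsum_of_dominated_convergence (bound := fun k => B * r ^ k)
    ((summable_geometric_of_lt_one hr0 hr).mul_left B) (fun k => ?_)
    (Eventually.of_forall fun l k => (h l k).trans
      (mul_le_mul_of_nonneg_left (pow_le_pow_of_le_one hr0 hr.le (by omega)) hB))
  split_ifs with hk
  · simpa [hk] using h0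
  · refine squeeze_zero_norm (a := fun l => B * r ^ l) (fun l => (h l k).trans ?_) ?_
    · refine mul_le_mul_of_nonneg_left (pow_le_pow_of_le_one hr0 hr.le ?_) hB
      nlinarith [Nat.pos_of_ne_zero hk]
    · simpa using (tendsto_pow_atTop_nhds_zero_of_lt_one hr0 hr).const_mul B

/-- The series `∑ R^(d k² + 2 l k) u_k`. -/
noncomputable def quadSeries (R : ℂ) (d : ℕ) (u : ℕ → ℂ) (l : ℕ) : ℂ :=
  ∑' k : ℕ, R ^ (d * k ^ 2 + 2 * l * k) * u k

theorem summable_quadSeries {R : ℂ} (hR : ‖R‖ < 1) {d : ℕ} (hd : 0 < d) {u : ℕ → ℂ}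
    (hu : ∃ B, ∀ k, ‖u k‖ ≤ B) (l : ℕ) :
    Summable fun k : ℕ => R ^ (d * k ^ 2 + 2 * l * k) * u k := by
  obtain ⟨B, hB⟩ := hu
  exact summable_of_norm_le_pow (norm_nonneg R) hR fun k =>
    norm_pow_quadratic_mul_le hR (hB k) hd l k

theorem tendsto_quadSeries {R : ℂ} (hR : ‖R‖ < 1) {d : ℕ} (hd : 0 < d) {u : ℕ → ℂ}
    (hu : ∃ B, ∀ k, ‖u k‖ ≤ B) : Tendsto (quadSeries R d u) atTop (𝓝 (u 0)) := by
  obtain ⟨B, hB⟩ := hu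
  refine tendsto_tsum_of_norm_le_pow (norm_nonneg R) hR
    (fun l k => norm_pow_quadratic_mul_le hR (hB k) hd l k) ?_
  simp

/-! ### The Rogers series and Euler's series -/

/-- `1 / (R⁴; R⁴)_k`. -/
noncomputable def rogersCoeff (R : ℂ) (k : ℕ) : ℂ := (qPoch (R ^ 4) (R ^ 4) k)⁻¹

theorem exists_norm_rogersCoeff_le {R : ℂ} (hR : ‖R‖ < 1) : ∃ B, ∀ k, ‖rogersCoeff R k‖ ≤ B :=
  exists_norm_inv_qPoch_le (norm_pow_lt_one hR four_ne_zero) (norm_pow_lt_one hR four_ne_zero)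

theorem one_sub_pow_mul_rogersCoeff_succ {R : ℂ} (hR : ‖R‖ < 1) (k : ℕ) :
    (1 - R ^ (4 * (k + 1))) * rogersCoeff R (k + 1) = rogersCoeff R k := by
  rw [pow_mul]
  exact one_sub_pow_mul_inv_qPoch_succ (norm_pow_lt_one hR four_ne_zero) k

/-- The Rogers series `∑ R^(k² + 2 l k) / (R⁴; R⁴)_k`. -/
noncomputable def rogersSeries (R : ℂ) (l : ℕ) : ℂ := quadSeries R 1 (rogersCoeff R) l

theorem tendsto_rogersSeries {R : ℂ} (hR : ‖R‖ < 1) :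
    Tendsto (rogersSeries R) atTop (𝓝 1) := by
  have h := tendsto_quadSeries hR one_pos (exists_norm_rogersCoeff_le hR)
  rwa [rogersCoeff, qPoch_zero, inv_one] at h

theorem rogersSeries_rec {R : ℂ} (hR : ‖R‖ < 1) (l : ℕ) :
    rogersSeries R l = rogersSeries R (l + 2) + R ^ (2 * l + 1) * rogersSeries R (l + 1) := by
  have hs := summable_quadSeries hR one_pos (exists_norm_rogersCoeff_le hR)
  have h := tsum_eq_tsum_of_shift ((hs l).sub (hs (l + 2)))
    (g := fun k => R ^ (2 * l + 1) * (R ^ (1 * k ^ 2 + 2 * (l + 1) * k) * rogersCoeff R k))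
    (by simp) (fun k => by
      rw [← one_sub_pow_mul_rogersCoeff_succ hR k]
      ring)
  rw [(hs l).tsum_sub (hs (l + 2)), tsum_mul_left] at h
  simp only [rogersSeries, quadSeries]
  linear_combination h

/-- The Casoratian of the Rogers series at `R` and `-R`. -/
theorem rogersSeries_casoratian {R : ℂ} (hR : ‖R‖ < 1) :
    rogersSeries R 0 * rogersSeries (-R) 1 + rogersSeries (-R) 0 * rogersSeries R 1 = 2 := by
  have hR' : ‖-R‖ < 1 := by rwa [norm_neg]
  set w : ℕ → ℂ := fun l => rogersSeries R l * rogersSeries (-R) (l + 1) +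
    rogersSeries (-R) l * rogersSeries R (l + 1) with hw
  have hstep : ∀ l, w l = w 0 := by
    intro l
    induction l with
    | zero => rfl
    | succ l ih =>
      rw [← ih]
      -- The exponent is odd, so the middle terms of the two recurrences have opposite signs and
      -- cancel in `w`.
      have e : (-R) ^ (2 * l + 1) = -R ^ (2 * l + 1) := (odd_two_mul_add_one l).neg_pow R
      have h2 := rogersSeries_rec hR' l
      rw [e] at h2
      simp only [hw]
      rw [rogersSeries_rec hR l, h2]
      ring
  have hlim : Tendsto w atTop (𝓝 (1 * 1 + 1 * 1)) :=
    ((tendsto_rogersSeries hR).mul ((tendsto_add_atTop_iff_nat 1).2 (tendsto_rogersSeries hR'))).add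
      ((tendsto_rogersSeries hR').mul ((tendsto_add_atTop_iff_nat 1).2 (tendsto_rogersSeries hR)))
  have := tendsto_nhds_unique (tendsto_const_nhds.congr fun l => (hstep l).symm) hlim
  simp only [hw] at this
  rw [zero_add] at this
  rw [this]
  norm_num

/-- Euler's series `∑ R^(j² + 2 n j) / (R²; R²)_j`. -/
noncomputable def eulerSeries (R : ℂ) (n : ℕ) : ℂ :=
  quadSeries R 1 (fun j => (qPoch (R ^ 2) (R ^ 2) j)⁻¹) n

theorem eulerSeries_rec {R : ℂ} (hR : ‖R‖ < 1) (n : ℕ) :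
    eulerSeries R n = (1 - (-R) * (R ^ 2) ^ n) * eulerSeries R (n + 1) := by
  have hR2 := norm_pow_lt_one hR two_ne_zero
  have hs := summable_quadSeries hR one_pos (exists_norm_inv_qPoch_le hR2 hR2)
  have h := tsum_eq_tsum_of_shift ((hs n).sub (hs (n + 1)))
    (g := fun k => R ^ (2 * n + 1) * (R ^ (1 * k ^ 2 + 2 * (n + 1) * k) *
      (qPoch (R ^ 2) (R ^ 2) k)⁻¹))
    (by simp) (fun k => by
      rw [← one_sub_pow_mul_inv_qPoch_succ hR2 k]
      ring)
  rw [(hs n).tsum_sub (hs (n + 1)), tsum_mul_left] at h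
  simp only [eulerSeries, quadSeries]
  linear_combination h

theorem eulerSeries_zero {R : ℂ} (hR : ‖R‖ < 1) :
    eulerSeries R 0 = qPochInf (-R) (R ^ 2) := by
  have hR2 := norm_pow_lt_one hR two_ne_zero
  have hstep : ∀ n, qPoch (-R) (R ^ 2) n * eulerSeries R n = eulerSeries R 0 := by
    intro n
    induction n with
    | zero => simp [qPoch_zero]
    | succ n ih => rw [← ih, eulerSeries_rec hR n, qPoch_succ]; ring
  have h1 : Tendsto (eulerSeries R) atTop (𝓝 1) := by
    have h := tendsto_quadSeries hR one_pos (exists_norm_inv_qPoch_le hR2 hR2)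
    rwa [qPoch_zero, inv_one] at h
  have h2 := (tendsto_qPoch (-R) hR2).mul h1
  rw [mul_one] at h2
  exact tendsto_nhds_unique (tendsto_const_nhds.congr fun n => (hstep n).symm) h2

/-! ### Slater-type series and their reduction to the Rogers series -/

/-- The coefficients `1 / ((R⁴; R⁴)_k (R; R²)_m)`. -/
noncomputable def slaterCoeff (R : ℂ) (k m : ℕ) : ℂ := rogersCoeff R k * (qPoch R (R ^ 2) m)⁻¹

theorem exists_norm_slaterCoeff_le {R : ℂ} (hR : ‖R‖ < 1) :
    ∃ B, ∀ k m, ‖slaterCoeff R k m‖ ≤ B := by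
  obtain ⟨B, hB⟩ := exists_norm_rogersCoeff_le hR
  obtain ⟨C, hC⟩ := exists_norm_inv_qPoch_le hR (norm_pow_lt_one hR two_ne_zero)
  refine ⟨B * C, fun k m => ?_⟩
  rw [slaterCoeff, norm_mul]
  exact mul_le_mul (hB k) (hC m) (norm_nonneg _) ((norm_nonneg _).trans (hB k))

theorem slaterCoeff_succ_left {R : ℂ} (hR : ‖R‖ < 1) (k m : ℕ) :
    (1 - R ^ (4 * (k + 1))) * slaterCoeff R (k + 1) m = slaterCoeff R k m := by
  rw [slaterCoeff, ← mul_assoc, one_sub_pow_mul_rogersCoeff_succ hR, slaterCoeff]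

theorem slaterCoeff_succ_right {R : ℂ} (hR : ‖R‖ < 1) (k m : ℕ) :
    (1 - R ^ (2 * m + 1)) * slaterCoeff R k (m + 1) = slaterCoeff R k m := by
  rw [slaterCoeff, mul_left_comm, slaterCoeff,
    ← one_sub_mul_inv_qPoch_succ hR (norm_pow_lt_one hR two_ne_zero) m]
  ring

/-- The series `∑ R^(3k² + 2 n k) / ((R⁴; R⁴)_k (R; R²)_(k+1))`. -/
noncomputable def residueSeries (R : ℂ) (n : ℕ) : ℂ :=
  quadSeries R 3 (fun k => slaterCoeff R k (k + 1)) n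

theorem exists_norm_slaterCoeff_diag_le {R : ℂ} (hR : ‖R‖ < 1) (m : ℕ → ℕ) :
    ∃ B, ∀ k, ‖slaterCoeff R k (m k)‖ ≤ B :=
  (exists_norm_slaterCoeff_le hR).imp fun _ h k => h k (m k)

theorem tendsto_residueSeries {R : ℂ} (hR : ‖R‖ < 1) :
    Tendsto (residueSeries R) atTop (𝓝 (1 - R)⁻¹) := by
  have h := tendsto_quadSeries hR three_pos (exists_norm_slaterCoeff_diag_le hR (· + 1))
  have e : slaterCoeff R 0 (0 + 1) = (1 - R)⁻¹ := by
    simp [slaterCoeff, rogersCoeff, qPoch_succ, qPoch_zero]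
  rwa [e] at h

/-- Raising n by one multiplies the k-th term by R^(2k), so the left side multiplies it by (1 -
R^(4k))(1 - R^(2k+1)). This vanishes at k = 0 and otherwise lowers both denominators by one step.
The recurrence is the adjoint of `exTen_rec`. -/
theorem residueSeries_rec {R : ℂ} (hR : ‖R‖ < 1) (n : ℕ) :
    residueSeries R n - R * residueSeries R (n + 1) - residueSeries R (n + 2) +
      R * residueSeries R (n + 3) = R ^ (2 * n + 3) * residueSeries R (n + 3) := by
  have hs := summable_quadSeries hR three_pos (exists_norm_slaterCoeff_diag_le hR (· + 1))
  have h := tsum_eq_tsum_of_shift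
    ((((hs n).sub ((hs (n + 1)).mul_left R)).sub (hs (n + 2))).add ((hs (n + 3)).mul_left R))
    (g := fun k => R ^ (2 * n + 3) * (R ^ (3 * k ^ 2 + 2 * (n + 3) * k) *
      slaterCoeff R k (k + 1)))
    (by simp) (fun k => by
      rw [← slaterCoeff_succ_left hR k, ← slaterCoeff_succ_right hR (k + 1) (k + 1)]
      ring)
  rw [(((hs n).sub ((hs (n + 1)).mul_left R)).sub (hs (n + 2))).tsum_add
    ((hs (n + 3)).mul_left R), ((hs n).sub ((hs (n + 1)).mul_left R)).tsum_sub (hs (n + 2)),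
    (hs n).tsum_sub ((hs (n + 1)).mul_left R), tsum_mul_left, tsum_mul_left, tsum_mul_left] at h
  exact h

/-- The series `∑ R^(3k² + 2 l k) / ((R⁴; R⁴)_k (R; R²)_(k+l))`. -/
noncomputable def slaterSeries (R : ℂ) (l : ℕ) : ℂ :=
  quadSeries R 3 (fun k => slaterCoeff R k (k + l)) l

theorem summable_slaterSeries {R : ℂ} (hR : ‖R‖ < 1) (l : ℕ) :
    Summable fun k : ℕ => R ^ (3 * k ^ 2 + 2 * l * k) * slaterCoeff R k (k + l) :=
  summable_quadSeries hR three_pos (exists_norm_slaterCoeff_diag_le hR (· + l)) l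

theorem tendsto_slaterSeries {R : ℂ} (hR : ‖R‖ < 1) :
    Tendsto (slaterSeries R) atTop (𝓝 (qPochInf R (R ^ 2))⁻¹) := by
  obtain ⟨B, hB⟩ := exists_norm_slaterCoeff_le hR
  refine tendsto_tsum_of_norm_le_pow (norm_nonneg R) hR
    (fun l k => norm_pow_quadratic_mul_le hR (hB k (k + l)) three_pos l k) ?_
  simpa [slaterCoeff, rogersCoeff, qPoch_zero] using
    tendsto_inv_qPoch hR (norm_pow_lt_one hR two_ne_zero)

theorem slaterSeries_one (R : ℂ) : slaterSeries R 1 = residueSeries R 1 := rfl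

theorem slaterSeries_zero {R : ℂ} (hR : ‖R‖ < 1) :
    slaterSeries R 0 = residueSeries R 0 - R * residueSeries R 1 := by
  have hs := summable_quadSeries hR three_pos (exists_norm_slaterCoeff_diag_le hR (· + 1))
  rw [residueSeries, residueSeries, quadSeries, quadSeries, ← tsum_mul_left,
    ← (hs 0).tsum_sub ((hs 1).mul_left R)]
  refine tsum_congr fun k => ?_
  beta_reduce
  rw [add_zero, ← slaterCoeff_succ_right hR k k]
  ring

/-- The defect of `slaterSeries` in the recurrence of the Rogers series. -/
noncomputable def slaterDefect (R : ℂ) (l : ℕ) : ℂ :=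
  slaterSeries R l - slaterSeries R (l + 2) + R ^ (2 * l + 1) * slaterSeries R (l + 1)

/-- The defect as a series with denominators `(R⁴; R⁴)_k (R; R²)_(k+l+2)`. -/
theorem slaterDefect_eq_tsum {R : ℂ} (hR : ‖R‖ < 1) (l : ℕ) :
    slaterDefect R l = ∑' k : ℕ, R ^ (3 * k ^ 2 + 2 * l * k) *
      ((1 - R ^ (4 * k) - R ^ (2 * k + 2 * l + 3)) * slaterCoeff R k (k + l + 2)) := by
  have hs := summable_slaterSeries hR
  rw [slaterDefect, slaterSeries, slaterSeries, slaterSeries, quadSeries, quadSeries, quadSeries,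
    ← tsum_mul_left, ← (hs l).tsum_sub (hs (l + 2)),
    ← ((hs l).sub (hs (l + 2))).tsum_add ((hs (l + 1)).mul_left _)]
  refine tsum_congr fun k => ?_
  rw [← add_assoc, ← add_assoc, ← slaterCoeff_succ_right hR k (k + l),
    ← slaterCoeff_succ_right hR k (k + l + 1)]
  ring

/-- The part with 1 - R^(4k) is reindexed by k → k + 1; the other part is brought to the denominator
(R;R²)_(k+l+3). Their difference has again the shape of `slaterDefect_eq_tsum`, with l + 1 for l. -/
theorem slaterDefect_rec {R : ℂ} (hR : ‖R‖ < 1) (l : ℕ) :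
    slaterDefect R l = -R ^ (2 * l + 3) * slaterDefect R (l + 1) := by
  have hs := fun m => summable_quadSeries hR three_pos (exists_norm_slaterCoeff_diag_le hR m)
  have hA : Summable fun k : ℕ => R ^ (3 * k ^ 2 + 2 * l * k) *
      ((1 - R ^ (4 * k)) * slaterCoeff R k (k + l + 2)) :=
    ((hs (· + l + 2) l).sub (hs (· + l + 2) (l + 2))).congr fun k => by ring
  have hB : Summable fun k : ℕ => R ^ (3 * k ^ 2 + 2 * l * k) *
      (R ^ (2 * k + 2 * l + 3) * slaterCoeff R k (k + l + 2)) :=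
    ((hs (· + l + 2) (l + 1)).mul_left (R ^ (2 * l + 3))).congr fun k => by ring
  have hC : Summable fun k : ℕ => R ^ (2 * l + 3) * (R ^ (3 * k ^ 2 + 2 * (l + 3) * k) *
      slaterCoeff R k (k + l + 3)) := (hs (· + l + 3) (l + 3)).mul_left _
  have h := tsum_eq_tsum_of_shift hA (g := fun k => R ^ (2 * l + 3) *
      (R ^ (3 * k ^ 2 + 2 * (l + 3) * k) * slaterCoeff R k (k + l + 3)))
    (by simp) (fun k => by
      rw [slaterCoeff_succ_left hR k, show k + 1 + l + 2 = k + l + 3 by ring]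
      ring)
  rw [slaterDefect_eq_tsum hR, slaterDefect_eq_tsum hR, ← tsum_mul_left]
  have e : ∀ k : ℕ, R ^ (3 * k ^ 2 + 2 * l * k) *
      ((1 - R ^ (4 * k) - R ^ (2 * k + 2 * l + 3)) * slaterCoeff R k (k + l + 2)) =
      R ^ (3 * k ^ 2 + 2 * l * k) * ((1 - R ^ (4 * k)) * slaterCoeff R k (k + l + 2)) -
      R ^ (3 * k ^ 2 + 2 * l * k) *
        (R ^ (2 * k + 2 * l + 3) * slaterCoeff R k (k + l + 2)) := fun k => by ring
  rw [tsum_congr e, hA.tsum_sub hB, h, ← hC.tsum_sub hB]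
  refine tsum_congr fun k => ?_
  rw [← slaterCoeff_succ_right hR k (k + l + 2), show k + (l + 1) + 2 = k + l + 3 by ring]
  ring

/-- By `slaterDefect_rec` the norm of the defect is nondecreasing in l, yet it tends to zero because
`slaterSeries` converges. -/
theorem slaterDefect_eq_zero {R : ℂ} (hR : ‖R‖ < 1) (l : ℕ) : slaterDefect R l = 0 := by
  have hmono : Monotone fun l => ‖slaterDefect R l‖ := by
    refine monotone_nat_of_le_succ fun l => ?_
    rw [slaterDefect_rec hR l, norm_mul, norm_neg, norm_pow]
    exact mul_le_of_le_one_left (norm_nonneg _) (pow_le_one₀ (norm_nonneg R) hR.le)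
  have ht := tendsto_slaterSeries hR
  have hpow : Tendsto (fun l : ℕ => R ^ (2 * l + 1)) atTop (𝓝 0) := by
    simp only [pow_add, pow_mul]
    rw [← zero_mul (R ^ 1)]
    exact (tendsto_pow_atTop_nhds_zero_of_norm_lt_one
      (norm_pow_lt_one hR two_ne_zero)).mul_const _
  have hlim : Tendsto (slaterDefect R) atTop (𝓝 0) := by
    have h := (ht.sub ((tendsto_add_atTop_iff_nat 2).2 ht)).add
      (hpow.mul ((tendsto_add_atTop_iff_nat 1).2 ht))
    rwa [sub_self, zero_mul, add_zero] at h
  have := hmono.ge_of_tendsto (tendsto_norm_zero.comp hlim) l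
  exact norm_le_zero_iff.1 this

/-- A solution of the recurrence of the Rogers series that tends to zero vanishes. -/
theorem eq_zero_of_rec_of_tendsto {R : ℂ} (hR : ‖R‖ < 1) {d : ℕ → ℂ}
    (hd : ∀ l, d l = d (l + 2) - R ^ (2 * l + 1) * d (l + 1)) (h : Tendsto d atTop (𝓝 0))
    (l : ℕ) : d l = 0 := by
  set r := ‖R‖ with hr
  have hr0 : 0 ≤ r := norm_nonneg R
  set W : ℕ → ℝ := fun l => max ‖d l‖ ‖d (l + 1)‖ with hW
  have hW0 : ∀ l, 0 ≤ W l := fun l => (norm_nonneg _).trans (le_max_left _ _)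
  have hstep : ∀ l, W l ≤ (1 + r ^ l) * W (l + 1) := by
    intro l
    have h1 : ‖d (l + 1)‖ ≤ W (l + 1) := le_max_left _ _
    have h2 : ‖d (l + 2)‖ ≤ W (l + 1) := le_max_right _ _
    have h3 : r ^ (2 * l + 1) ≤ r ^ l := pow_le_pow_of_le_one hr0 hR.le (by omega)
    have h4 : 0 ≤ r ^ l * W (l + 1) := mul_nonneg (pow_nonneg hr0 l) (hW0 _)
    refine max_le ?_ (by linarith)
    rw [hd l]
    refine (norm_sub_le _ _).trans ?_
    rw [norm_mul, norm_pow, ← hr]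
    have h5 := mul_le_mul h3 h1 (norm_nonneg _) (pow_nonneg hr0 l)
    linarith
  -- A discrete Gronwall argument: the products converge, so this nondecreasing nonnegative sequence
  -- tends to zero.
  have hmono : Monotone fun l => (∏ j ∈ Finset.range l, (1 + r ^ j)) * W l := by
    refine monotone_nat_of_le_succ fun l => ?_
    rw [Finset.prod_range_succ, mul_assoc]
    exact mul_le_mul_of_nonneg_left (hstep l) (Finset.prod_nonneg fun j _ => by positivity)
  have hprod := (Real.multipliable_one_add_of_summable
    (summable_geometric_of_lt_one hr0 hR)).hasProd.tendsto_prod_nat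
  have hWlim : Tendsto W atTop (𝓝 0) := by
    simpa using (tendsto_norm_zero.comp h).max
      (tendsto_norm_zero.comp ((tendsto_add_atTop_iff_nat 1).2 h))
  have hlim := hprod.mul hWlim
  rw [mul_zero] at hlim
  have hpos : 0 < ∏ j ∈ Finset.range l, (1 + r ^ j) :=
    Finset.prod_pos fun j _ => by positivity
  have hle : W l ≤ 0 := nonpos_of_mul_nonpos_right (hmono.ge_of_tendsto hlim l) hpos
  exact norm_le_zero_iff.1 ((le_max_left _ _).trans hle)

theorem slaterSeries_eq {R : ℂ} (hR : ‖R‖ < 1) (l : ℕ) :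
    slaterSeries R l = rogersSeries (-R) l * (qPochInf R (R ^ 2))⁻¹ := by
  have hR' : ‖-R‖ < 1 := by rwa [norm_neg]
  refine sub_eq_zero.1 (eq_zero_of_rec_of_tendsto hR
    (d := fun l => slaterSeries R l - rogersSeries (-R) l * (qPochInf R (R ^ 2))⁻¹)
    (fun l => ?_) ?_ l)
  · have h1 := slaterDefect_eq_zero hR l
    have h2 := rogersSeries_rec hR' l
    rw [(odd_two_mul_add_one l).neg_pow R] at h2
    rw [slaterDefect] at h1
    linear_combination h1 - (qPochInf R (R ^ 2))⁻¹ * h2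
  · have h := (tendsto_slaterSeries hR).sub
      ((tendsto_rogersSeries hR').mul_const (qPochInf R (R ^ 2))⁻¹)
    rwa [one_mul, sub_self] at h

/-! ### The reciprocal `q`-shifted factorial at integers -/

/-- `1 / (x; x)_n`, extended by zero to negative `n`. -/
noncomputable def invPoch (x : ℂ) (n : ℤ) : ℂ := if n < 0 then 0 else (qPoch x x n.toNat)⁻¹

theorem invPoch_natCast (x : ℂ) (n : ℕ) : invPoch x n = (qPoch x x n)⁻¹ := by
  simp [invPoch]

theorem invPoch_of_neg (x : ℂ) {n : ℤ} (hn : n < 0) : invPoch x n = 0 := if_pos hn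

theorem invPoch_zero (x : ℂ) : invPoch x 0 = 1 := by
  simpa [qPoch_zero] using invPoch_natCast x 0

/-- Extension by zero makes this valid at every integer: at n = 0 the factor 1 - x⁰ vanishes. Double
series can thus run over ℤ × ℤ, where index shifts are bijections without boundary terms. -/
theorem one_sub_zpow_mul_invPoch {x : ℂ} (hx : ‖x‖ < 1) (n : ℤ) :
    (1 - x ^ n) * invPoch x n = invPoch x (n - 1) := by
  rcases lt_trichotomy n 0 with hn | rfl | hn
  · rw [invPoch_of_neg x hn, invPoch_of_neg x (by omega), mul_zero]
  · rw [invPoch_of_neg x (by omega : (0 : ℤ) - 1 < 0), zpow_zero, sub_self, zero_mul]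
  · obtain ⟨k, rfl⟩ : ∃ k : ℕ, n = (k + 1 : ℕ) := ⟨(n - 1).toNat, by omega⟩
    rw [show ((k + 1 : ℕ) : ℤ) - 1 = (k : ℕ) by push_cast; ring, invPoch_natCast, invPoch_natCast,
      zpow_natCast, one_sub_pow_mul_inv_qPoch_succ hx]

theorem exists_norm_invPoch_le {x : ℂ} (hx : ‖x‖ < 1) : ∃ B, ∀ n, ‖invPoch x n‖ ≤ B := by
  obtain ⟨B, hB⟩ := exists_norm_inv_qPoch_le hx hx
  refine ⟨B, fun n => ?_⟩
  unfold invPoch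
  split_ifs
  · simpa using (norm_nonneg _).trans (hB 0)
  · exact hB _

theorem tendsto_invPoch {x : ℂ} (hx : ‖x‖ < 1) (c : ℤ) :
    Tendsto (fun k : ℕ => invPoch x (k + c)) atTop (𝓝 (qPochInf x x)⁻¹) := by
  have h : Tendsto (fun k : ℕ => ((k : ℤ) + c).toNat) atTop atTop := by
    refine tendsto_atTop.2 fun b => ?_
    filter_upwards [eventually_ge_atTop (b + c.natAbs)] with k hk
    omega
  refine ((tendsto_inv_qPoch hx hx).comp h).congr' ?_
  filter_upwards [eventually_ge_atTop c.natAbs] with k hk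
  rw [invPoch, if_neg (by omega), Function.comp_apply]

/-! ### Summability of double series -/

theorem summable_pow_natAbs {r : ℝ} (hr0 : 0 ≤ r) (hr : r < 1) :
    Summable fun n : ℤ => r ^ n.natAbs :=
  Summable.of_nat_of_neg (by simpa using summable_geometric_of_lt_one hr0 hr)
    (by simpa using summable_geometric_of_lt_one hr0 hr)

/-- An exponent that dominates `|i| + |j|` up to a constant. -/
def Coercive (E : ℤ × ℤ → ℤ) : Prop := ∃ K : ℤ, ∀ p, |p.1| + |p.2| ≤ E p + K

theorem Coercive.of_quadratic {q : ℤ × ℤ → ℤ} (hq : ∀ p, p.1 ^ 2 + p.2 ^ 2 ≤ 2 * q p) (a b : ℤ) :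
    Coercive fun p => q p + a * p.1 + b * p.2 := by
  -- This is (|i| - (|a| + 1))² ≥ 0 combined with a i ≥ -|a||i|.
  have key : ∀ a i : ℤ, 2 * |i| ≤ i ^ 2 + 2 * (a * i) + (|a| + 1) ^ 2 := by
    intro a i
    have h1 : -(|a| * |i|) ≤ a * i := by rw [← abs_mul]; exact neg_abs_le _
    nlinarith [sq_nonneg (|i| - (|a| + 1)), sq_abs i]
  refine ⟨(|a| + 1) ^ 2 + (|b| + 1) ^ 2, fun p => ?_⟩
  have h1 := key a p.1
  have h2 := key b p.2
  have h3 := hq p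
  nlinarith [sq_nonneg (|a| + 1), sq_nonneg (|b| + 1)]

theorem Coercive.summable {E : ℤ × ℤ → ℤ} (hE : Coercive E) {r : ℝ} (hr0 : 0 < r) (hr : r < 1) :
    Summable fun p => r ^ E p := by
  obtain ⟨K, hK⟩ := hE
  have h := ((summable_pow_natAbs hr0.le hr).mul_of_nonneg (summable_pow_natAbs hr0.le hr)
    (fun _ => pow_nonneg hr0.le _) (fun _ => pow_nonneg hr0.le _)).mul_left (r ^ (-K))
  refine h.of_nonneg_of_le (fun p => (zpow_pos hr0 _).le) fun p => ?_
  rw [← pow_add, ← zpow_natCast, ← zpow_add₀ hr0.ne']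
  refine zpow_le_zpow_right_of_le_one₀ hr0 hr.le ?_
  have := hK p
  push_cast
  linarith

theorem Coercive.summable_mul {E : ℤ × ℤ → ℤ} (hE : Coercive E) {s : ℂ} (hs0 : s ≠ 0)
    (hs : ‖s‖ < 1) {u : ℤ × ℤ → ℂ} (hu : ∃ B, ∀ p, ‖u p‖ ≤ B) :
    Summable fun p => s ^ E p * u p := by
  obtain ⟨B, hB⟩ := hu
  refine ((hE.summable (norm_pos_iff.2 hs0) hs).mul_right B).of_norm_bounded fun p => ?_
  rw [norm_mul, norm_zpow]
  exact mul_le_mul_of_nonneg_left (hB p) (zpow_nonneg (norm_nonneg s) _)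

/-- The coefficients `1 / ((x; x)_i (x; x)_j)`. -/
noncomputable def invPoch₂ (x : ℂ) (p : ℤ × ℤ) : ℂ := invPoch x p.1 * invPoch x p.2

theorem exists_norm_invPoch_mul_le {x : ℂ} (hx : ‖x‖ < 1) :
    ∃ B, 0 ≤ B ∧ ∀ i j, ‖invPoch x i * invPoch x j‖ ≤ B := by
  obtain ⟨B, hB⟩ := exists_norm_invPoch_le hx
  have h0 : 0 ≤ B := (norm_nonneg _).trans (hB 0)
  refine ⟨B * B, mul_nonneg h0 h0, fun i j => ?_⟩
  rw [norm_mul]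
  exact mul_le_mul (hB _) (hB _) (norm_nonneg _) h0

theorem exists_norm_invPoch₂_le {x : ℂ} (hx : ‖x‖ < 1) : ∃ B, ∀ p, ‖invPoch₂ x p‖ ≤ B := by
  obtain ⟨B, -, hB⟩ := exists_norm_invPoch_mul_le hx
  exact ⟨B, fun p => hB _ _⟩

/-- The double series `∑ s^E(i,j) / ((s⁶; s⁶)_i (s⁶; s⁶)_j)`. -/
noncomputable def nahmSum (s : ℂ) (E : ℤ × ℤ → ℤ) : ℂ :=
  ∑' p : ℤ × ℤ, s ^ E p * invPoch₂ (s ^ 6) p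

theorem Coercive.summable_nahm {E : ℤ × ℤ → ℤ} (hE : Coercive E) {s : ℂ} (hs0 : s ≠ 0)
    (hs : ‖s‖ < 1) : Summable fun p => s ^ E p * invPoch₂ (s ^ 6) p :=
  hE.summable_mul hs0 hs (exists_norm_invPoch₂_le (norm_pow_lt_one hs (by norm_num)))

theorem zpow_add_six_mul {s : ℂ} (hs0 : s ≠ 0) (e n : ℤ) :
    s ^ (e + 6 * n) = s ^ e * (s ^ 6) ^ n := by
  rw [zpow_add₀ hs0, zpow_mul]
  rfl

theorem nahmSum_shift_fst {s : ℂ} (hs0 : s ≠ 0) (hs : ‖s‖ < 1) {E E' F : ℤ × ℤ → ℤ}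
    (hE : Coercive E) (hE' : Coercive E') (h' : ∀ p, E' p = E p + 6 * p.1) (c : ℤ)
    (hF : ∀ p : ℤ × ℤ, E (p + (1, 0)) = c + F p) :
    nahmSum s E - nahmSum s E' = s ^ c * nahmSum s F := by
  have h6 : ‖s ^ 6‖ < 1 := norm_pow_lt_one hs (by norm_num)
  rw [nahmSum, nahmSum, ← (hE.summable_nahm hs0 hs).tsum_sub (hE'.summable_nahm hs0 hs),
    ← (Equiv.addRight ((1, 0) : ℤ × ℤ)).tsum_eq, nahmSum, ← tsum_mul_left]
  refine tsum_congr fun p => ?_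
  have h := one_sub_zpow_mul_invPoch h6 (p.1 + 1)
  rw [add_sub_cancel_right] at h
  rw [Equiv.coe_addRight, h', zpow_add_six_mul hs0, hF, zpow_add₀ hs0]
  simp only [invPoch₂, Prod.fst_add, Prod.snd_add, add_zero]
  rw [← h]
  ring

theorem nahmSum_shift_snd {s : ℂ} (hs0 : s ≠ 0) (hs : ‖s‖ < 1) {E E' F : ℤ × ℤ → ℤ}
    (hE : Coercive E) (hE' : Coercive E') (h' : ∀ p, E' p = E p + 6 * p.2) (c : ℤ)
    (hF : ∀ p : ℤ × ℤ, E (p + (0, 1)) = c + F p) :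
    nahmSum s E - nahmSum s E' = s ^ c * nahmSum s F := by
  have h6 : ‖s ^ 6‖ < 1 := norm_pow_lt_one hs (by norm_num)
  rw [nahmSum, nahmSum, ← (hE.summable_nahm hs0 hs).tsum_sub (hE'.summable_nahm hs0 hs),
    ← (Equiv.addRight ((0, 1) : ℤ × ℤ)).tsum_eq, nahmSum, ← tsum_mul_left]
  refine tsum_congr fun p => ?_
  have h := one_sub_zpow_mul_invPoch h6 (p.2 + 1)
  rw [add_sub_cancel_right] at h
  rw [Equiv.coe_addRight, h', zpow_add_six_mul hs0, hF, zpow_add₀ hs0]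
  simp only [invPoch₂, Prod.fst_add, Prod.snd_add, add_zero]
  rw [← h]
  ring

/-! ### The two families of double series -/

/-- The exponent `(i - j)² + 3j² + a i + b j`. -/
def exponentN (a b : ℤ) (p : ℤ × ℤ) : ℤ := ((p.1 - p.2) ^ 2 + 3 * p.2 ^ 2) + a * p.1 + b * p.2

/-- The exponent `4i² + 4ij + 4j² + a i + b j`. -/
def exponentM (a b : ℤ) (p : ℤ × ℤ) : ℤ :=
  (4 * p.1 ^ 2 + 4 * p.1 * p.2 + 4 * p.2 ^ 2) + a * p.1 + b * p.2

theorem coercive_exponentN (a b : ℤ) : Coercive (exponentN a b) :=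
  Coercive.of_quadratic (fun p => by nlinarith [sq_nonneg (p.1 - 2 * p.2)]) a b

theorem coercive_exponentM (a b : ℤ) : Coercive (exponentM a b) :=
  Coercive.of_quadratic
    (fun p => by nlinarith [sq_nonneg (p.1 + p.2), sq_nonneg p.1, sq_nonneg p.2]) a b

theorem nahmSum_exponentN_fst {s : ℂ} (hs0 : s ≠ 0) (hs : ‖s‖ < 1) (a b : ℤ) :
    nahmSum s (exponentN a b) - nahmSum s (exponentN (a + 6) b) =
      s ^ (a + 1) * nahmSum s (exponentN (a + 2) (b - 2)) :=
  nahmSum_shift_fst hs0 hs (coercive_exponentN _ _) (coercive_exponentN _ _)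
    (fun p => by simp only [exponentN]; ring) _
    (fun p => by simp only [exponentN, Prod.fst_add, Prod.snd_add]; ring)

theorem nahmSum_exponentN_snd {s : ℂ} (hs0 : s ≠ 0) (hs : ‖s‖ < 1) (a b : ℤ) :
    nahmSum s (exponentN a b) - nahmSum s (exponentN a (b + 6)) =
      s ^ (b + 4) * nahmSum s (exponentN (a - 2) (b + 8)) :=
  nahmSum_shift_snd hs0 hs (coercive_exponentN _ _) (coercive_exponentN _ _)
    (fun p => by simp only [exponentN]; ring) _
    (fun p => by simp only [exponentN, Prod.fst_add, Prod.snd_add]; ring)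

theorem nahmSum_exponentM_fst {s : ℂ} (hs0 : s ≠ 0) (hs : ‖s‖ < 1) (a b : ℤ) :
    nahmSum s (exponentM a b) - nahmSum s (exponentM (a + 6) b) =
      s ^ (a + 4) * nahmSum s (exponentM (a + 8) (b + 4)) :=
  nahmSum_shift_fst hs0 hs (coercive_exponentM _ _) (coercive_exponentM _ _)
    (fun p => by simp only [exponentM]; ring) _
    (fun p => by simp only [exponentM, Prod.fst_add, Prod.snd_add]; ring)

theorem nahmSum_exponentM_snd {s : ℂ} (hs0 : s ≠ 0) (hs : ‖s‖ < 1) (a b : ℤ) :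
    nahmSum s (exponentM a b) - nahmSum s (exponentM a (b + 6)) =
      s ^ (b + 4) * nahmSum s (exponentM (a + 4) (b + 8)) :=
  nahmSum_shift_snd hs0 hs (coercive_exponentM _ _) (coercive_exponentM _ _)
    (fun p => by simp only [exponentM]; ring) _
    (fun p => by simp only [exponentM, Prod.fst_add, Prod.snd_add]; ring)

/-- The family `s^(l²) ∑ s^((i-j)² + 3j² + (4l+3)i - 4lj) / ((s⁶; s⁶)_i (s⁶; s⁶)_j)`. -/
noncomputable def exFive (s : ℂ) (l : ℤ) : ℂ :=
  s ^ (l ^ 2) * nahmSum s (exponentN (4 * l + 3) (-(4 * l)))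

/-- The family `s^(n²) ∑ s^(4i² + 4ij + 4j² - 4ni - 2nj) / ((s⁶; s⁶)_i (s⁶; s⁶)_j)`. -/
noncomputable def exTen (s : ℂ) (n : ℤ) : ℂ :=
  s ^ (n ^ 2) * nahmSum s (exponentM (-(4 * n)) (-(2 * n)))

/-- Three contiguous relations; the auxiliary sums with i-coefficient 4l + 1 are eliminated. -/
theorem exFive_rec {s : ℂ} (hs0 : s ≠ 0) (hs : ‖s‖ < 1) (l : ℤ) :
    exFive s (l - 1) = exFive s (l + 1) + s ^ (6 * l + 3) * exFive s l := by
  have h1 := nahmSum_exponentN_snd hs0 hs (4 * l + 1) (-(4 * l) - 4)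
  have h2 := nahmSum_exponentN_fst hs0 hs (4 * l + 1) (-(4 * l) - 4)
  have h3 := nahmSum_exponentN_snd hs0 hs (4 * l + 3) (-(4 * l) - 6)
  rw [show -(4 * l) - 4 + 4 = -(4 * l) by ring, show 4 * l + 1 - 2 = 4 * (l - 1) + 3 by ring,
    show -(4 * l) - 4 + 8 = -(4 * (l - 1)) by ring] at h1
  rw [show 4 * l + 1 + 6 = 4 * (l + 1) + 3 by ring, show 4 * l + 1 + 1 = 4 * l + 2 by ring,
    show 4 * l + 1 + 2 = 4 * l + 3 by ring, show -(4 * l) - 4 - 2 = -(4 * l) - 6 by ring,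
    show -(4 * l) - 4 = -(4 * (l + 1)) by ring] at h2
  rw [show -(4 * l) - 6 + 6 = -(4 * l) by ring, show -(4 * l) - 6 + 4 = -(4 * l + 2) by ring,
    show 4 * l + 3 - 2 = 4 * l + 1 by ring,
    show -(4 * l) - 6 + 8 = -(4 * l) - 4 + 6 by ring] at h3
  rw [show -(4 * l) - 4 = -(4 * (l + 1)) by ring] at h1 h3
  have e1 : s ^ ((l - 1) ^ 2) = s ^ ((l + 1) ^ 2) * s ^ (-(4 * l)) := by
    rw [← zpow_add₀ hs0]; ring_nf
  have e2 : s ^ (6 * l + 3) * s ^ (l ^ 2) = s ^ ((l + 1) ^ 2) * s ^ (4 * l + 2) := by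
    rw [← zpow_add₀ hs0, ← zpow_add₀ hs0]; ring_nf
  have e3 : s ^ (4 * l + 2) * s ^ (-(4 * l + 2)) = 1 := by
    rw [← zpow_add₀ hs0, add_neg_cancel, zpow_zero]
  simp only [exFive]
  rw [← mul_assoc, e2, e1]
  linear_combination s ^ ((l + 1) ^ 2) * (-h1 + h2 + s ^ (4 * l + 2) * h3 +
    nahmSum s (exponentN (4 * l + 1) (-(4 * (l + 1)) + 6)) * e3)

theorem exTen_rec {s : ℂ} (hs0 : s ≠ 0) (hs : ‖s‖ < 1) (n : ℤ) :
    exTen s (n + 3) = s ^ 3 * exTen s (n + 2) + exTen s (n + 1) -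
      s ^ 3 * (1 - s ^ (6 * (n + 1))) * exTen s n := by
  -- `D` raises the j-coefficient of `exTen` by 6, `D'` raises both coefficients by 6, and `T` is a
  -- multiple of `exTen s n`. The relations `hj`, `hi`, `hT`, `hTn` then eliminate `D` and `D'`.
  set D : ℤ → ℂ := fun m =>
    s ^ (m ^ 2) * nahmSum s (exponentM (-(4 * m)) (-(2 * m) + 6)) with hD
  set T : ℂ := s ^ ((n + 3) ^ 2) * nahmSum s (exponentM (-(4 * n)) (-(2 * n)))
  set D' : ℤ → ℂ := fun m =>
    s ^ (m ^ 2) * nahmSum s (exponentM (-(4 * m) + 6) (-(2 * m) + 6)) with hD'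
  have hj : ∀ m, exTen s m = D m + s ^ 3 * D (m - 1) := by
    intro m
    have h := nahmSum_exponentM_snd hs0 hs (-(4 * m)) (-(2 * m))
    rw [show -(4 * m) + 4 = -(4 * (m - 1)) by ring,
      show -(2 * m) + 8 = -(2 * (m - 1)) + 6 by ring] at h
    have e : s ^ (m ^ 2) * s ^ (-(2 * m) + 4) = s ^ 3 * s ^ ((m - 1) ^ 2) := by
      rw [← zpow_natCast s 3, ← zpow_add₀ hs0, ← zpow_add₀ hs0]; push_cast; ring_nf
    simp only [exTen, hD]
    linear_combination s ^ (m ^ 2) * h +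
      nahmSum s (exponentM (-(4 * (m - 1))) (-(2 * (m - 1)) + 6)) * e
  have hi : ∀ m, D m - D' m = D (m - 2) := by
    intro m
    have h := nahmSum_exponentM_fst hs0 hs (-(4 * m)) (-(2 * m) + 6)
    rw [show -(4 * m) + 8 = -(4 * (m - 2)) by ring,
      show -(2 * m) + 6 + 4 = -(2 * (m - 2)) + 6 by ring] at h
    have e : s ^ (m ^ 2) * s ^ (-(4 * m) + 4) = s ^ ((m - 2) ^ 2) := by
      rw [← zpow_add₀ hs0]; ring_nf
    simp only [hD, hD']
    linear_combination s ^ (m ^ 2) * h +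
      nahmSum s (exponentM (-(4 * (m - 2))) (-(2 * (m - 2)) + 6)) * e
  have hT : D' (n + 3) - T = s ^ 6 * D' (n + 1) := by
    have h := nahmSum_exponentM_fst hs0 hs (-(4 * (n + 3)) + 6) (-(2 * (n + 3)) + 6)
    rw [show -(4 * (n + 3)) + 6 + 6 = -(4 * n) by ring,
      show -(4 * (n + 3)) + 6 + 8 = -(4 * (n + 1)) + 6 by ring,
      show -(2 * (n + 3)) + 6 + 4 = -(2 * (n + 1)) + 6 by ring] at h
    have e : s ^ ((n + 3) ^ 2) * s ^ (-(4 * (n + 3)) + 6 + 4) = s ^ 6 * s ^ ((n + 1) ^ 2) := by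
      rw [← zpow_natCast s 6, ← zpow_add₀ hs0, ← zpow_add₀ hs0]; push_cast; ring_nf
    have h0 : -(2 * (n + 3)) + 6 = -(2 * n) := by ring
    simp only [hD', T]
    rw [h0] at h ⊢
    linear_combination s ^ ((n + 3) ^ 2) * h +
      nahmSum s (exponentM (-(4 * (n + 1)) + 6) (-(2 * (n + 1)) + 6)) * e
  have hTn : T = s ^ 3 * s ^ (6 * (n + 1)) * exTen s n := by
    have e : s ^ ((n + 3) ^ 2) = s ^ 3 * s ^ (6 * (n + 1)) * s ^ (n ^ 2) := by
      rw [← zpow_natCast s 3, ← zpow_add₀ hs0, ← zpow_add₀ hs0]; push_cast; ring_nf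
    simp only [T, exTen]
    rw [e, mul_assoc]
  have h3 := hj (n + 3)
  have h2 := hj (n + 2)
  have h1 := hj (n + 1)
  have h0 := hj n
  have i3 := hi (n + 3)
  have i1 := hi (n + 1)
  rw [show n + 3 - 1 = n + 2 by ring] at h3
  rw [show n + 2 - 1 = n + 1 by ring] at h2
  rw [show n + 1 - 1 = n by ring] at h1
  rw [show n + 3 - 2 = n + 1 by ring] at i3
  rw [show n + 1 - 2 = n - 1 by ring] at i1
  linear_combination h3 - s ^ 3 * h2 - h1 + s ^ 3 * h0 + i3 - s ^ 6 * i1 + hT + hTn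

/-! ### Limits of the two families -/

theorem tsum_int_even_add_odd {f : ℤ → ℂ} (hf : Summable f) :
    ∑' c : ℤ, f (2 * c) + ∑' c : ℤ, f (2 * c + 1) = ∑' n, f n := by
  have he : Function.Injective fun c : ℤ => 2 * c := fun a b h => by simpa using h
  have ho : Function.Injective fun c : ℤ => 2 * c + 1 := fun a b h => by simpa using h
  have h1 := (he.hasSum_range_iff (f := f)).2 (hf.comp_injective he).hasSum
  have h2 := (ho.hasSum_range_iff (f := f)).2 (hf.comp_injective ho).hasSum
  refine (HasSum.add_isCompl ?_ h1 h2).tsum_eq.symm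
  have e1 : (Set.range fun c : ℤ => 2 * c) = {n | Even n} :=
    Set.ext fun n => by simp only [Set.mem_range, Set.mem_ofPred_eq, even_iff_exists_two_mul, eq_comm]
  have e2 : (Set.range fun c : ℤ => 2 * c + 1) = {n | Odd n} :=
    Set.ext fun n => by simp only [Set.mem_range, Set.mem_ofPred_eq, Odd, eq_comm]
  rw [e1, e2]
  exact Int.isCompl_even_odd

theorem summable_zpow_sq {s : ℂ} (hs : ‖s‖ < 1) : Summable fun n : ℤ => s ^ (n ^ 2) := by
  refine (summable_pow_natAbs (norm_nonneg s) hs).of_norm_bounded fun n => ?_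
  have e : (n ^ 2 : ℤ) = ((n.natAbs ^ 2 : ℕ) : ℤ) := by push_cast; rw [sq_abs]
  rw [norm_zpow, e, zpow_natCast]
  exact pow_le_pow_of_le_one (norm_nonneg s) hs.le (Nat.le_self_pow two_ne_zero _)

/-- The theta series `∑ s^(n²)` over the integers. -/
noncomputable def thetaSeries (s : ℂ) : ℂ := ∑' n : ℤ, s ^ (n ^ 2)

theorem tsum_even_sq_add_tsum_odd_sq {s : ℂ} (hs : ‖s‖ < 1) (j : ℤ) :
    ∑' c : ℤ, s ^ ((2 * c + j) ^ 2) + ∑' c : ℤ, s ^ ((2 * c + 1 + j) ^ 2) = thetaSeries s := by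
  have h := tsum_int_even_add_odd
    ((summable_zpow_sq hs).comp_injective (Equiv.addRight j).injective)
  exact h.trans ((Equiv.addRight j).tsum_eq fun n : ℤ => s ^ (n ^ 2))

theorem tendsto_pow_zpow {s : ℂ} (hs : ‖s‖ < 1) {i : ℤ} (hi : 0 < i) :
    Tendsto (fun k : ℕ => s ^ (6 * (k : ℤ) * i)) atTop (𝓝 0) := by
  obtain ⟨m, rfl⟩ := Int.eq_ofNat_of_zero_le hi.le
  have hm : m ≠ 0 := by rintro rfl; simp at hi
  refine (tendsto_pow_atTop_nhds_zero_of_norm_lt_one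
    (norm_pow_lt_one hs (mul_ne_zero (by norm_num : (6 : ℕ) ≠ 0) hm))).congr fun k => ?_
  rw [← pow_mul, ← zpow_natCast]
  push_cast
  ring_nf

/-- Dominated convergence: terms with i < 0 are zero, those with i > 0 decay like s^(6ki), and only
i = 0 survives. -/
theorem tendsto_tsum_exFive {s : ℂ} (hs0 : s ≠ 0) (hs : ‖s‖ < 1) {E : ℤ × ℤ → ℤ}
    (hE : Coercive E) :
    Tendsto (fun k : ℕ => ∑' p : ℤ × ℤ, s ^ (E p + 6 * (k : ℤ) * p.1) *
      (invPoch (s ^ 6) p.1 * invPoch (s ^ 6) (k + p.2))) atTop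
      (𝓝 ((∑' c : ℤ, s ^ E (0, c)) * (qPochInf (s ^ 6) (s ^ 6))⁻¹)) := by
  have h6 : ‖s ^ 6‖ < 1 := norm_pow_lt_one hs (by norm_num)
  obtain ⟨B, hB0, hB⟩ := exists_norm_invPoch_mul_le h6
  set ρ := (qPochInf (s ^ 6) (s ^ 6))⁻¹
  have hinj : Function.Injective fun c : ℤ => ((0, c) : ℤ × ℤ) := fun a b h => by simpa using h
  have hlim : ∑' p : ℤ × ℤ, (if p.1 = 0 then s ^ E p * ρ else 0) =
      (∑' c : ℤ, s ^ E (0, c)) * ρ := by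
    rw [← hinj.tsum_eq, ← tsum_mul_right]
    · simp
    · rintro ⟨i, c⟩ hp
      by_cases hi : i = 0
      · exact ⟨c, by rw [hi]⟩
      · simp [hi] at hp
  rw [← hlim]
  refine tendsto_tsum_of_dominated_convergence
    (bound := fun p => ‖s‖ ^ E p * B) ((hE.summable (norm_pos_iff.2 hs0) hs).mul_right B)
    (fun p => ?_) (Eventually.of_forall fun k p => ?_)
  · rcases lt_trichotomy p.1 0 with hi | hi | hi
    · simp [invPoch_of_neg _ hi, hi.ne]
    · simp only [hi, mul_zero, add_zero, if_true, invPoch_zero, one_mul]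
      exact (tendsto_invPoch h6 p.2).const_mul _
    · rw [if_neg hi.ne']
      have h1 := ((tendsto_pow_zpow hs hi).const_mul (s ^ E p)).mul
        ((tendsto_invPoch h6 p.2).const_mul (invPoch (s ^ 6) p.1))
      rw [mul_zero, zero_mul] at h1
      exact h1.congr fun k => by rw [zpow_add₀ hs0]
  · rcases lt_or_ge p.1 0 with hi | hi
    · rw [invPoch_of_neg _ hi, zero_mul, mul_zero, norm_zero]
      exact mul_nonneg (zpow_nonneg (norm_nonneg s) _) hB0
    · rw [norm_mul, norm_zpow]
      refine mul_le_mul (zpow_le_zpow_right_of_le_one₀ (norm_pos_iff.2 hs0) hs.le ?_) (hB _ _)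
        (norm_nonneg _) (zpow_nonneg (norm_nonneg s) _)
      have : 0 ≤ 6 * (k : ℤ) * p.1 := by positivity
      linarith

theorem tendsto_tsum_exTen {s : ℂ} (hs0 : s ≠ 0) (hs : ‖s‖ < 1) {E : ℤ × ℤ → ℤ}
    (hE : Coercive E) :
    Tendsto (fun k : ℕ => ∑' p : ℤ × ℤ, s ^ E p *
      (invPoch (s ^ 6) (k + p.1) * invPoch (s ^ 6) p.2)) atTop
      (𝓝 ((∑' p : ℤ × ℤ, s ^ E p * invPoch (s ^ 6) p.2) * (qPochInf (s ^ 6) (s ^ 6))⁻¹)) := by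
  have h6 : ‖s ^ 6‖ < 1 := norm_pow_lt_one hs (by norm_num)
  obtain ⟨B, -, hB⟩ := exists_norm_invPoch_mul_le h6
  rw [← tsum_mul_right]
  refine tendsto_tsum_of_dominated_convergence
    (bound := fun p => ‖s‖ ^ E p * B) ((hE.summable (norm_pos_iff.2 hs0) hs).mul_right B)
    (fun p => ?_) (Eventually.of_forall fun k p => ?_)
  · have h := ((tendsto_invPoch h6 p.1).mul_const (invPoch (s ^ 6) p.2)).const_mul (s ^ E p)
    rwa [mul_comm _ (invPoch (s ^ 6) p.2), ← mul_assoc] at h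
  · rw [norm_mul, norm_zpow]
    exact mul_le_mul_of_nonneg_left (hB _ _) (zpow_nonneg (norm_nonneg s) _)

theorem exFive_eq_tsum {s : ℂ} (hs0 : s ≠ 0) (l m : ℤ) :
    exFive s l = ∑' p : ℤ × ℤ, s ^ (l ^ 2 + exponentN (4 * l + 3) (-(4 * l)) (p.1, m + p.2)) *
      (invPoch (s ^ 6) p.1 * invPoch (s ^ 6) (m + p.2)) := by
  rw [exFive, nahmSum, ← tsum_mul_left,
    ← ((Equiv.refl ℤ).prodCongr (Equiv.addLeft m)).tsum_eq]
  refine tsum_congr fun p => ?_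
  rw [zpow_add₀ hs0, mul_assoc]
  rfl

theorem exTen_eq_tsum {s : ℂ} (hs0 : s ≠ 0) (n m : ℤ) :
    exTen s n = ∑' p : ℤ × ℤ, s ^ (n ^ 2 + exponentM (-(4 * n)) (-(2 * n)) (m + p.1, p.2)) *
      (invPoch (s ^ 6) (m + p.1) * invPoch (s ^ 6) p.2) := by
  rw [exTen, nahmSum, ← tsum_mul_left,
    ← ((Equiv.addLeft m).prodCongr (Equiv.refl ℤ)).tsum_eq]
  refine tsum_congr fun p => ?_
  rw [zpow_add₀ hs0, mul_assoc]
  rfl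

theorem Coercive.add_const {E : ℤ × ℤ → ℤ} (hE : Coercive E) (c : ℤ) :
    Coercive fun p => E p + c := by
  obtain ⟨K, hK⟩ := hE
  exact ⟨K - c, fun p => by linarith [hK p]⟩

/-- At i = 0 the full exponent is (2j - l)². Centring j at k, for l = 2k, leaves the even squares;
odd l gives the odd ones. -/
theorem tendsto_exFive_even {s : ℂ} (hs0 : s ≠ 0) (hs : ‖s‖ < 1) :
    Tendsto (fun k : ℕ => exFive s (2 * k)) atTop
      (𝓝 ((∑' c : ℤ, s ^ ((2 * c + 0) ^ 2)) * (qPochInf (s ^ 6) (s ^ 6))⁻¹)) := by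
  have h := tendsto_tsum_exFive hs0 hs (coercive_exponentN 3 0)
  have e : ∀ c : ℤ, exponentN 3 0 (0, c) = (2 * c + 0) ^ 2 := fun c => by
    simp only [exponentN]; ring
  simp only [e] at h
  refine h.congr fun k => ?_
  rw [exFive_eq_tsum hs0 _ k]
  refine tsum_congr fun p => ?_
  congr 2
  simp only [exponentN]
  ring

theorem tendsto_exFive_odd {s : ℂ} (hs0 : s ≠ 0) (hs : ‖s‖ < 1) :
    Tendsto (fun k : ℕ => exFive s (2 * k - 1)) atTop
      (𝓝 ((∑' c : ℤ, s ^ ((2 * c + 1 + 0) ^ 2)) * (qPochInf (s ^ 6) (s ^ 6))⁻¹)) := by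
  have h := tendsto_tsum_exFive hs0 hs ((coercive_exponentN (-1) 4).add_const 1)
  have e : ∀ c : ℤ, exponentN (-1) 4 (0, c) + 1 = (2 * c + 1 + 0) ^ 2 := fun c => by
    simp only [exponentN]; ring
  simp only [e] at h
  refine h.congr fun k => ?_
  rw [exFive_eq_tsum hs0 _ k]
  refine tsum_congr fun p => ?_
  congr 2
  simp only [exponentN]
  ring

/-- Centring i at k makes the exponent independent of k, so only the factor 1/(x;x)_(k+i), x = s⁶,
moves. -/
theorem tendsto_exTen_even {s : ℂ} (hs0 : s ≠ 0) (hs : ‖s‖ < 1) :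
    Tendsto (fun k : ℕ => exTen s (2 * k)) atTop
      (𝓝 ((∑' p : ℤ × ℤ, s ^ exponentM 0 0 p * invPoch (s ^ 6) p.2) *
        (qPochInf (s ^ 6) (s ^ 6))⁻¹)) := by
  refine (tendsto_tsum_exTen hs0 hs (coercive_exponentM 0 0)).congr fun k => ?_
  rw [exTen_eq_tsum hs0 _ k]
  refine tsum_congr fun p => ?_
  congr 2
  simp only [exponentM]
  ring

theorem tendsto_exTen_odd {s : ℂ} (hs0 : s ≠ 0) (hs : ‖s‖ < 1) :
    Tendsto (fun k : ℕ => exTen s (2 * k - 1)) atTop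
      (𝓝 ((∑' p : ℤ × ℤ, s ^ (exponentM 4 2 p + 1) * invPoch (s ^ 6) p.2) *
        (qPochInf (s ^ 6) (s ^ 6))⁻¹)) := by
  refine (tendsto_tsum_exTen hs0 hs ((coercive_exponentM 4 2).add_const 1)).congr fun k => ?_
  rw [exTen_eq_tsum hs0 _ k]
  refine tsum_congr fun p => ?_
  congr 2
  simp only [exponentM]
  ring

theorem tsum_int_eq_eulerSeries (s : ℂ) :
    ∑' j : ℤ, s ^ (3 * j ^ 2) * invPoch (s ^ 6) j = eulerSeries (s ^ 3) 0 := by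
  have hinj : Function.Injective fun k : ℕ => (k : ℤ) := Nat.cast_injective
  rw [← hinj.tsum_eq, eulerSeries, quadSeries]
  · refine tsum_congr fun k => ?_
    rw [invPoch_natCast, ← pow_mul, ← pow_mul, ← zpow_natCast s (3 * (1 * k ^ 2 + 2 * 0 * k))]
    push_cast
    ring_nf
  · intro j hj
    refine ⟨j.toNat, Int.toNat_of_nonneg ?_⟩
    by_contra hneg
    simp [invPoch_of_neg _ (not_le.1 hneg)] at hj

/-- The exponents are (2i + j)² + 3j² and (2i + 1 + j)² + 3j². For fixed j the two sums over i
together run through all squares, and the theta series factors out. -/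
theorem tsum_exponentM_add {s : ℂ} (hs0 : s ≠ 0) (hs : ‖s‖ < 1) :
    ∑' p : ℤ × ℤ, s ^ exponentM 0 0 p * invPoch (s ^ 6) p.2 +
      ∑' p : ℤ × ℤ, s ^ (exponentM 4 2 p + 1) * invPoch (s ^ 6) p.2 =
      thetaSeries s * eulerSeries (s ^ 3) 0 := by
  have h6 : ‖s ^ 6‖ < 1 := norm_pow_lt_one hs (by norm_num)
  obtain ⟨B, hB⟩ := exists_norm_invPoch_le h6
  have h1 := (coercive_exponentM 0 0).summable_mul hs0 hs (u := fun p => invPoch (s ^ 6) p.2)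
    ⟨B, fun p => hB _⟩
  have h2 := ((coercive_exponentM 4 2).add_const 1).summable_mul hs0 hs
    (u := fun p => invPoch (s ^ 6) p.2) ⟨B, fun p => hB _⟩
  rw [← tsum_int_eq_eulerSeries, ← tsum_mul_left, ← (Equiv.prodComm ℤ ℤ).tsum_eq,
    ← (Equiv.prodComm ℤ ℤ).tsum_eq (fun p : ℤ × ℤ => s ^ (exponentM 4 2 p + 1) * _)]
  have h1' := h1.comp_injective (Equiv.prodComm ℤ ℤ).injective
  have h2' := h2.comp_injective (Equiv.prodComm ℤ ℤ).injective
  simp only [Function.comp_def] at h1' h2'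
  rw [h1'.tsum_prod, h2'.tsum_prod, ← h1'.prod.tsum_add h2'.prod]
  refine tsum_congr fun j => ?_
  rw [← tsum_even_sq_add_tsum_odd_sq hs j, add_mul, ← tsum_mul_right, ← tsum_mul_right]
  congr 1
  · refine tsum_congr fun c => ?_
    rw [← mul_assoc, ← zpow_add₀ hs0]
    congr 2
    simp only [exponentM, Equiv.prodComm_apply, Prod.swap]
    ring
  · refine tsum_congr fun c => ?_
    rw [← mul_assoc, ← zpow_add₀ hs0]
    congr 2
    simp only [exponentM, Equiv.prodComm_apply, Prod.swap]
    ring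

/-! ### Invariants of the recurrences -/

theorem tendsto_two_mul_atTop : Tendsto (fun k : ℕ => 2 * k) atTop atTop :=
  tendsto_id.const_mul_atTop' two_pos

theorem exFive_connection {s : ℂ} (hs0 : s ≠ 0) (hs : ‖s‖ < 1) :
    rogersSeries (-s ^ 3) 0 * exFive s 0 + rogersSeries (-s ^ 3) 1 * exFive s (-1) =
      thetaSeries s * (qPochInf (s ^ 6) (s ^ 6))⁻¹ := by
  have hR : ‖-s ^ 3‖ < 1 := by rw [norm_neg]; exact norm_pow_lt_one hs three_ne_zero
  set J : ℕ → ℂ := fun l => rogersSeries (-s ^ 3) l * exFive s l +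
    rogersSeries (-s ^ 3) (l + 1) * exFive s (l - 1) with hJ
  have hstep : ∀ l, J l = J 0 := by
    intro l
    induction l with
    | zero => rfl
    | succ l ih =>
      rw [← ih]
      have h1 := rogersSeries_rec hR l
      have h2 := exFive_rec hs0 hs l
      have e : s ^ (6 * (l : ℤ) + 3) = -(-s ^ 3) ^ (2 * l + 1) := by
        rw [(odd_two_mul_add_one l).neg_pow, neg_neg, ← pow_mul, ← zpow_natCast]
        push_cast
        ring_nf
      rw [e] at h2
      simp only [hJ]
      rw [h1, h2]
      push_cast
      rw [add_sub_cancel_right]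
      ring
  have hr := tendsto_rogersSeries hR
  have hlim := ((hr.comp tendsto_two_mul_atTop).mul (tendsto_exFive_even hs0 hs)).add
    ((((tendsto_add_atTop_iff_nat 1).2 hr).comp tendsto_two_mul_atTop).mul
      (tendsto_exFive_odd hs0 hs))
  rw [one_mul, one_mul, ← add_mul, tsum_even_sq_add_tsum_odd_sq hs 0] at hlim
  have hconst : Tendsto (fun k : ℕ => J (2 * k)) atTop (𝓝 (J 0)) :=
    tendsto_const_nhds.congr fun k => (hstep _).symm
  have h := tendsto_nhds_unique (hconst.congr fun k => by simp [hJ]) hlim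
  simpa [hJ] using h

theorem exTen_connection {s : ℂ} (hs0 : s ≠ 0) (hs : ‖s‖ < 1) :
    slaterSeries (s ^ 3) 0 * exTen s 0 + slaterSeries (s ^ 3) 1 * exTen s 1 =
      thetaSeries s * eulerSeries (s ^ 3) 0 * (qPochInf (s ^ 6) (s ^ 6))⁻¹ := by
  have hR : ‖s ^ 3‖ < 1 := norm_pow_lt_one hs three_ne_zero
  set R := s ^ 3 with hRdef
  set g := residueSeries R with hg
  -- The bilinear invariant of the two adjoint recurrences. At k = 0 the factor 1 - R^(2k) removes
  -- `exTen s (-1)`.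
  set I : ℕ → ℂ := fun k => -R * (1 - R ^ (2 * k)) * g (k + 2) * exTen s (k - 1) +
    (g k - R * g (k + 1)) * exTen s k + g (k + 1) * exTen s (k + 1) with hI
  have hstep : ∀ k, I k = I 0 := by
    intro k
    induction k with
    | zero => rfl
    | succ k ih =>
      rw [← ih]
      have h1 := residueSeries_rec hR k
      have h2 := exTen_rec hs0 hs (k - 1)
      have e : s ^ (6 * ((k : ℤ) - 1 + 1)) = R ^ (2 * k) := by
        rw [hRdef, ← pow_mul, ← zpow_natCast]
        push_cast
        ring_nf
      rw [e, ← hRdef, show (k : ℤ) - 1 + 3 = k + 2 by ring, show (k : ℤ) - 1 + 2 = k + 1 by ring,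
        show (k : ℤ) - 1 + 1 = k by ring] at h2
      simp only [hI]
      push_cast
      rw [add_sub_cancel_right, add_assoc (k : ℤ) 1 1, one_add_one_eq_two, add_assoc k 1 1,
        one_add_one_eq_two, show k + 1 + 2 = k + 3 by ring, h2]
      rw [← hg] at h1
      linear_combination -exTen s k * h1
  have hlg := tendsto_residueSeries hR
  have hshift : ∀ m, Tendsto (fun k : ℕ => g (2 * k + m)) atTop (𝓝 (1 - R)⁻¹) := fun m =>
    ((tendsto_add_atTop_iff_nat m).2 hlg).comp tendsto_two_mul_atTop
  have hpow : Tendsto (fun k : ℕ => R ^ (2 * (2 * k))) atTop (𝓝 0) :=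
    (tendsto_pow_atTop_nhds_zero_of_norm_lt_one hR).comp
      (tendsto_two_mul_atTop.comp tendsto_two_mul_atTop)
  have hE := tendsto_exTen_even hs0 hs
  have hO := tendsto_exTen_odd hs0 hs
  have hO' := (tendsto_add_atTop_iff_nat 1).2 hO
  -- With O and E the odd and even limits of `exTen`, the limit is (1 - R)⁻¹ (-R·O + (1 - R)·E + O)
  -- = E + O.
  have hlim := (((((hpow.const_sub 1).const_mul (-R)).mul (hshift 2)).mul hO).add
    (((hshift 0).sub ((hshift 1).const_mul R)).mul hE)).add ((hshift 1).mul hO')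
  have hconst : Tendsto (fun k : ℕ => I (2 * k)) atTop (𝓝 (I 0)) :=
    tendsto_const_nhds.congr fun k => (hstep _).symm
  have h := tendsto_nhds_unique (hconst.congr fun k => by
    simp only [hI]
    push_cast
    rw [show 2 * ((k : ℤ) + 1) - 1 = 2 * k + 1 by ring, add_zero]) hlim
  have hne := one_sub_ne_zero_of_norm_lt hR
  rw [← tsum_exponentM_add hs0 hs, slaterSeries_zero hR, slaterSeries_one, ← hg]
  simp only [hI] at h
  norm_num at h
  rw [h]
  field_simp
  ring

theorem exTen_connection_rogers {s : ℂ} (hs0 : s ≠ 0) (hs : ‖s‖ < 1) :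
    qPochInf (-s ^ 6) (s ^ 6) *
      (rogersSeries (-s ^ 3) 0 * exTen s 0 + rogersSeries (-s ^ 3) 1 * exTen s 1) =
      thetaSeries s * (qPochInf (s ^ 6) (s ^ 6))⁻¹ := by
  have hR : ‖s ^ 3‖ < 1 := norm_pow_lt_one hs three_ne_zero
  have e : (s ^ 3) ^ 2 = s ^ 6 := by ring
  have h := exTen_connection hs0 hs
  have ht := qPochInf_triple_product hR
  have hne := qPochInf_ne_zero hR (norm_pow_lt_one hR two_ne_zero)
  rw [slaterSeries_eq hR, slaterSeries_eq hR, eulerSeries_zero hR] at h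
  rw [e] at h ht hne
  have hi := mul_inv_cancel₀ hne
  linear_combination qPochInf (-s ^ 6) (s ^ 6) * qPochInf (s ^ 3) (s ^ 6) * h -
    qPochInf (-s ^ 6) (s ^ 6) * (rogersSeries (-s ^ 3) 0 * exTen s 0 +
      rogersSeries (-s ^ 3) 1 * exTen s 1) * hi +
    thetaSeries s * (qPochInf (s ^ 6) (s ^ 6))⁻¹ * ht

/-! ### Comparison of the double series -/

/-- The exponent of a Nahm sum in `q = s²`, as an exponent of `s`. -/
def doubleExponent (e : ℤ → ℤ → ℤ) (p : ℤ × ℤ) : ℤ := 2 * e p.1 p.2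

theorem doubleExponent_exponent1 : doubleExponent exponent1 = exponentN (-1) 4 := by
  funext p
  have h : (2 : ℤ) ∣ p.1 ^ 2 - p.1 := by
    rw [show p.1 ^ 2 - p.1 = p.1 * (p.1 - 1) by ring]
    exact (Int.even_mul_pred_self p.1).two_dvd
  simp only [doubleExponent, exponent1, exponentN]
  linear_combination Int.mul_ediv_cancel' h

theorem doubleExponent_exponent2 : doubleExponent exponent2 = exponentN 3 0 := by
  funext p
  have h : (2 : ℤ) ∣ p.1 ^ 2 + 3 * p.1 := by
    rw [show p.1 ^ 2 + 3 * p.1 = p.1 * (p.1 + 1) + 2 * p.1 by ring]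
    exact dvd_add (Int.even_mul_succ_self p.1).two_dvd (dvd_mul_right 2 _)
  simp only [doubleExponent, exponent2, exponentN]
  linear_combination Int.mul_ediv_cancel' h

theorem doubleExponent_exponent3 : doubleExponent exponent3 = exponentM (-4) (-2) := by
  funext p
  simp only [doubleExponent, exponent3, exponentM]
  ring

theorem doubleExponent_exponent4 : doubleExponent exponent4 = exponentM 0 0 := by
  funext p
  simp only [doubleExponent, exponent4, exponentM]
  ring

theorem nahmTerm_eq (e : ℤ → ℤ → ℤ) (s : ℂ) (p : ℕ × ℕ) :
    nahmTerm e (s ^ 2) p = s ^ doubleExponent e (Prod.map Nat.cast Nat.cast p) *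
      invPoch₂ (s ^ 6) (Prod.map Nat.cast Nat.cast p) := by
  have h6 : (s ^ 2) ^ 3 = s ^ 6 := by ring
  simp only [nahmTerm, h6, doubleExponent, invPoch₂, Prod.map_fst, Prod.map_snd, invPoch_natCast]
  rw [zpow_mul, div_eq_mul_inv, mul_inv]
  rfl

theorem injective_prodMap_natCast :
    Function.Injective (Prod.map Nat.cast Nat.cast : ℕ × ℕ → ℤ × ℤ) :=
  Nat.cast_injective.prodMap Nat.cast_injective

theorem summable_nahmTerm {s : ℂ} (hs0 : s ≠ 0) (hs : ‖s‖ < 1) {e : ℤ → ℤ → ℤ}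
    (he : Coercive (doubleExponent e)) : Summable (nahmTerm e (s ^ 2)) :=
  ((he.summable_nahm hs0 hs).comp_injective injective_prodMap_natCast).congr fun p =>
    (nahmTerm_eq e s p).symm

theorem tsum_nahmTerm (e : ℤ → ℤ → ℤ) (s : ℂ) :
    ∑' p, nahmTerm e (s ^ 2) p = nahmSum s (doubleExponent e) := by
  rw [nahmSum, ← injective_prodMap_natCast.tsum_eq]
  · exact tsum_congr fun p => nahmTerm_eq e s p
  · rintro ⟨i, j⟩ hp
    refine ⟨(i.toNat, j.toNat), ?_⟩
    by_cases hi : i < 0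
    · simp [invPoch₂, invPoch_of_neg _ hi] at hp
    by_cases hj : j < 0
    · simp [invPoch₂, invPoch_of_neg _ hj] at hp
    simp [Int.toNat_of_nonneg (not_lt.1 hi), Int.toNat_of_nonneg (not_lt.1 hj)]

theorem exFive_zero (s : ℂ) : exFive s 0 = S₂ (s ^ 2) := by
  rw [S₂, tsum_nahmTerm, doubleExponent_exponent2]
  simp [exFive]

theorem exFive_neg_one (s : ℂ) : exFive s (-1) = s * S₁ (s ^ 2) := by
  rw [S₁, tsum_nahmTerm, doubleExponent_exponent1]
  norm_num [exFive]

theorem exTen_zero (s : ℂ) : exTen s 0 = S₄ (s ^ 2) := by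
  rw [S₄, tsum_nahmTerm, doubleExponent_exponent4]
  simp [exTen]

theorem exTen_one (s : ℂ) : exTen s 1 = s * S₃ (s ^ 2) := by
  rw [S₃, tsum_nahmTerm, doubleExponent_exponent3]
  norm_num [exTen]

theorem nahm_relation {s : ℂ} (hs0 : s ≠ 0) (hs : ‖s‖ < 1) :
    rogersSeries (-s ^ 3) 0 * (S₂ (s ^ 2) - qPochInf (-s ^ 6) (s ^ 6) * S₄ (s ^ 2)) +
      s * rogersSeries (-s ^ 3) 1 * (S₁ (s ^ 2) - qPochInf (-s ^ 6) (s ^ 6) * S₃ (s ^ 2)) = 0 := by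
  have h1 := exFive_connection hs0 hs
  have h2 := exTen_connection_rogers hs0 hs
  rw [exFive_zero, exFive_neg_one] at h1
  rw [exTen_zero, exTen_one] at h2
  linear_combination h1 - h2

theorem nahm_identities_sq {s : ℂ} (hs0 : s ≠ 0) (hs : ‖s‖ < 1) :
    S₁ (s ^ 2) = qPochInf (-s ^ 6) (s ^ 6) * S₃ (s ^ 2) ∧
      S₂ (s ^ 2) = qPochInf (-s ^ 6) (s ^ 6) * S₄ (s ^ 2) := by
  have h1 := nahm_relation hs0 hs
  -- Replacing s by -s preserves s² and s⁶ but changes the sign of s³, so the Rogers series switch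
  -- from -s³ to s³.
  have h2 := nahm_relation (neg_ne_zero.2 hs0) (by rwa [norm_neg])
  rw [(by decide : Even 2).neg_pow, (by decide : Even 6).neg_pow, (by decide : Odd 3).neg_pow,
    neg_neg] at h2
  have hw := rogersSeries_casoratian (norm_pow_lt_one hs three_ne_zero)
  refine ⟨sub_eq_zero.1 ?_, sub_eq_zero.1 ?_⟩
  · refine (mul_eq_zero.1 (?_ : 2 * s * _ = 0)).resolve_left (mul_ne_zero two_ne_zero hs0)
    linear_combination rogersSeries (s ^ 3) 0 * h1 - rogersSeries (-s ^ 3) 0 * h2 -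
      s * (S₁ (s ^ 2) - qPochInf (-s ^ 6) (s ^ 6) * S₃ (s ^ 2)) * hw
  · refine (mul_eq_zero.1 (?_ : (2 : ℂ) * _ = 0)).resolve_left two_ne_zero
    linear_combination rogersSeries (s ^ 3) 1 * h1 + rogersSeries (-s ^ 3) 1 * h2 -
      (S₂ (s ^ 2) - qPochInf (-s ^ 6) (s ^ 6) * S₄ (s ^ 2)) * hw

/-! ### The case `q = 0` -/

theorem qPoch_zero_zero (n : ℕ) : qPoch 0 0 n = 1 := by simp [qPoch]

/-- At q = 0 each series counts the zeros of its exponent: two each for S₁ and S₃, one each for S₂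
and S₄. -/
theorem hasSum_nahmTerm_zero {e : ℤ → ℤ → ℤ} {t : Finset (ℕ × ℕ)}
    (h0 : ∀ p : ℕ × ℕ, p ∈ t ↔ e p.1 p.2 = 0) : HasSum (nahmTerm e 0) t.card := by
  have h := hasSum_sum_of_ne_finset_zero (L := .unconditional _) (f := nahmTerm e 0) (s := t) fun p hp => by
    rw [nahmTerm, zero_zpow _ (mt (h0 p).2 hp), zero_div]
  have h1 : ∀ p ∈ t, nahmTerm e 0 p = 1 := fun p hp => by
    simp [nahmTerm, (h0 p).1 hp, qPoch_zero_zero]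
  rwa [Finset.sum_congr rfl h1, Finset.sum_const, nsmul_one] at h

theorem qPochInf_zero_zero : qPochInf (-0 ^ 3) (0 ^ 3) = 1 := by simp [qPochInf]

theorem exponent1_eq_zero_iff (p : ℕ × ℕ) :
    p ∈ ({(0, 0), (1, 0)} : Finset (ℕ × ℕ)) ↔ exponent1 p.1 p.2 = 0 := by
  obtain ⟨i, j⟩ := p
  simp only [Finset.mem_insert, Finset.mem_singleton, Prod.mk.injEq]
  constructor
  · rintro (⟨rfl, rfl⟩ | ⟨rfl, rfl⟩) <;> simp [exponent1]
  · intro h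
    have h2 := congrFun doubleExponent_exponent1 ((i : ℤ), (j : ℤ))
    simp only [doubleExponent, exponentN, h] at h2
    have hn : 0 ≤ ((i : ℤ) - j) ^ 2 - ((i : ℤ) - j) := by
      rw [sub_nonneg]
      exact Int.le_self_sq _
    have hj : j = 0 := by
      have : (j : ℤ) ≤ 0 := by nlinarith [sq_nonneg (j : ℤ)]
      omega
    subst hj
    have hi : (i : ℤ) * (i - 1) = 0 := by push_cast at h2; linear_combination -h2
    rcases mul_eq_zero.1 hi with h | h <;> omega

theorem exponent2_eq_zero_iff (p : ℕ × ℕ) :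
    p ∈ ({(0, 0)} : Finset (ℕ × ℕ)) ↔ exponent2 p.1 p.2 = 0 := by
  obtain ⟨i, j⟩ := p
  simp only [Finset.mem_singleton, Prod.mk.injEq]
  constructor
  · rintro ⟨rfl, rfl⟩
    simp [exponent2]
  · intro h
    have h2 := congrFun doubleExponent_exponent2 ((i : ℤ), (j : ℤ))
    simp only [doubleExponent, exponentN, h] at h2
    have hi : (i : ℤ) ≤ 0 := by nlinarith [sq_nonneg ((i : ℤ) - j), sq_nonneg (j : ℤ)]
    have hj : (j : ℤ) ^ 2 = 0 :=
      le_antisymm (by nlinarith [sq_nonneg ((i : ℤ) - j)]) (sq_nonneg _)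
    exact ⟨by omega, by simpa using hj⟩

theorem exponent3_eq_zero_iff (p : ℕ × ℕ) :
    p ∈ ({(0, 0), (1, 0)} : Finset (ℕ × ℕ)) ↔ exponent3 p.1 p.2 = 0 := by
  obtain ⟨i, j⟩ := p
  simp only [Finset.mem_insert, Finset.mem_singleton, Prod.mk.injEq]
  constructor
  · rintro (⟨rfl, rfl⟩ | ⟨rfl, rfl⟩) <;> simp [exponent3]
  · intro h
    simp only [exponent3] at h
    have hi := Int.le_self_sq i
    have hj' := Int.le_self_sq j
    have hij : (0 : ℤ) ≤ i * j := by positivity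
    have hj : j = 0 := by
      have : (j : ℤ) ≤ 0 := by linarith
      omega
    subst hj
    have hi : (i : ℤ) * (i - 1) = 0 := by push_cast at h; linarith
    rcases mul_eq_zero.1 hi with h | h <;> omega

theorem exponent4_eq_zero_iff (p : ℕ × ℕ) :
    p ∈ ({(0, 0)} : Finset (ℕ × ℕ)) ↔ exponent4 p.1 p.2 = 0 := by
  obtain ⟨i, j⟩ := p
  simp only [Finset.mem_singleton, Prod.mk.injEq]
  constructor
  · rintro ⟨rfl, rfl⟩
    simp [exponent4]
  · intro h
    simp only [exponent4] at h
    have hij : (0 : ℤ) ≤ i * j := by positivity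
    have hi : (i : ℤ) ^ 2 = 0 := le_antisymm (by linarith [sq_nonneg (j : ℤ)]) (sq_nonneg _)
    have hj : (j : ℤ) ^ 2 = 0 := le_antisymm (by linarith [sq_nonneg (i : ℤ)]) (sq_nonneg _)
    exact ⟨by simpa using hi, by simpa using hj⟩

theorem theorem1p2 (q : ℂ) (hq : ‖q‖ < 1) :
    (Summable (nahmTerm exponent1 q) ∧ Summable (nahmTerm exponent2 q) ∧
      Summable (nahmTerm exponent3 q) ∧ Summable (nahmTerm exponent4 q) ∧
      Multipliable (fun k : ℕ => 1 - (-q ^ 3) * (q ^ 3) ^ k)) ∧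
    S₁ q = qPochInf (-q ^ 3) (q ^ 3) * S₃ q ∧
    S₂ q = qPochInf (-q ^ 3) (q ^ 3) * S₄ q := by
  have hm := multipliable_one_sub_mul_pow (-q ^ 3) (norm_pow_lt_one hq three_ne_zero)
  rcases eq_or_ne q 0 with rfl | hq0
  · have h1 := hasSum_nahmTerm_zero exponent1_eq_zero_iff
    have h2 := hasSum_nahmTerm_zero exponent2_eq_zero_iff
    have h3 := hasSum_nahmTerm_zero exponent3_eq_zero_iff
    have h4 := hasSum_nahmTerm_zero exponent4_eq_zero_iff
    refine ⟨⟨h1.summable, h2.summable, h3.summable, h4.summable, hm⟩, ?_, ?_⟩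
    · rw [qPochInf_zero_zero, one_mul, S₁, S₃, h1.tsum_eq, h3.tsum_eq]
    · rw [qPochInf_zero_zero, one_mul, S₂, S₄, h2.tsum_eq, h4.tsum_eq]
  · obtain ⟨s, rfl⟩ : ∃ s, q = s ^ 2 := by
      obtain ⟨s, hs⟩ := IsAlgClosed.exists_pow_nat_eq q two_pos
      exact ⟨s, hs.symm⟩
    have hs0 : s ≠ 0 := by rintro rfl; simp at hq0
    have hs : ‖s‖ < 1 := by
      rw [norm_pow] at hq
      exact (pow_lt_one_iff_of_nonneg (norm_nonneg s) two_ne_zero).1 hq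
    refine ⟨⟨?_, ?_, ?_, ?_, hm⟩, ?_⟩
    · exact summable_nahmTerm hs0 hs (doubleExponent_exponent1 ▸ coercive_exponentN _ _)
    · exact summable_nahmTerm hs0 hs (doubleExponent_exponent2 ▸ coercive_exponentN _ _)
    · exact summable_nahmTerm hs0 hs (doubleExponent_exponent3 ▸ coercive_exponentM _ _)
    · exact summable_nahmTerm hs0 hs (doubleExponent_exponent4 ▸ coercive_exponentM _ _)
    · rw [← pow_mul]
      exact nahm_identities_sq hs0 hs
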